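/- Let $r\ge 2$ and $n_{\mathrm{cp}}\ge 0$ be integers with $n_{\mathrm{cp}}<r-1$, and let $k\ge 1$ be an integer with $k\ge k^{\mathrm{MAIM}}$, where $$k^{\mathrm{MAIM}}=\Big\lceil \tfrac{r}{r-1-n_{\mathrm{cp}}}-2\Big\rceil+\frac{1+(-1)^{\lceil \frac{r}{r-1-n_{\mathrm{cp}}}-2\rceil}}{2}.$$ *The scheme.* Consider a uniform grid of mesh width $h=\Delta x$ with cells $I_j$ of centre $x_j$, interfaces $x_{j\pm1/2}=x_j\pm h/2$, and cell averages $\bar u_j=\frac1h\int_{I_j}u$. For $s=0,\dots,r-1$ let $p_s$ be the polynomial of degree at most $r-1$ whose averages over the cells $I_{j+s-r+1},\dots,I_{j+s}$ are the $\bar u$'s, put $u^{s}=p_s(x_{j+1/2})$, and let $d_s=\binom rs\binom{r-1}s\big/\binom{2r-1}{r}$ be the optimal weights, for which $\sum_s d_su^s$ is the value at $x_{j+1/2}$ of the reconstruction polynomial on the $2r-1$ cells $I_{j-r+1},\dots,I_{j+r-1}$. The Jiang–Shu indicators and weights are, with $\epsilon\ge0$, $$\beta_s=\sum_{l=1}^{r-1}\int_{I_j}h^{2l-1}\big(p_s^{(l)}(x)\big)^2dx,\qquad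 \omega^{\mathrm{JS}}_s=\frac{\alpha_s^{\mathrm{JS}}}{\sum_l\alpha_l^{\mathrm{JS}}},\qquad \alpha_s^{\mathrm{JS}}=\frac{d_s}{(\epsilon+\beta_s)^2}.$$ For constants $A>0$, $\delta>0$ let $\mathrm{sg}(x)=x/|x|$ if $|x|\ge\delta$ and $\mathrm{sg}(x)=x/\big((\delta^2-x^2)^{k+3}+|x|\big)$ if $|x|<\delta$, and $$f_s(\omega)=A\Big(\tfrac{1+(-1)^k}2+\tfrac{1+(-1)^{k+1}}2\,\mathrm{sg}(\omega-d_s)\Big),\qquad g_s(\omega)=d_s+\frac{f_s(\omega)(\omega-d_s)^{k+1}}{f_s(\omega)(\omega-d_s)^k+\omega^{a_s}(1-\omega)^{b_s}},$$ where, with a constant $\epsilon_A\ge0$, the exponents $a_s,b_s$ are of one of five types: (1) $a_s=\frac{d_s}{m_s\omega+\epsilon_A}$, $b_s=\frac{1-d_s}{m_s(1-\omega)+\epsilon_A}$ with $m_s>0$; (2) $a_s=b_s=1$ if $\mathrm{CFS}_s<\omega<1-\frac{1-d_s}{d_s}\mathrm{CFS}_s$ and $a_s=b_s=Qk$ otherwise,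 with $Q\ge1/k$ and $0<\mathrm{CFS}_s\le d_s$; (3) $a_s=b_s=\max_j\beta_j/(\min_j\beta_j+\epsilon_A)$; (4) $a_s=b_s=\max_j(\omega_j^{\mathrm{JS}}/d_j)\big/\big(\min_j(\omega_j^{\mathrm{JS}}/d_j)+\epsilon_A\big)$; (5) $a_s=b_s=C$ with a constant $C\ge1$. The WENO-MAIM$i$ weights (for type $i$) are $\omega_s=\alpha_s/\sum_l\alpha_l$ with $\alpha_s=g_s(\omega_s^{\mathrm{JS}})$, and $u^-_{j+1/2}=\sum_s\omega_su^s$; the value $u^+_{j+1/2}$ is obtained by the mirror-symmetric procedure, centred at $I_{j+1}$. For the conservation law $u_t+f(u)_x=0$ with $f\in C^2(\mathbb R)$, and a constant $\alpha$, the numerical flux is the Lax–Friedrichs flux $\hat f_{j+1/2}=\frac12\big[f(u^-_{j+1/2})+f(u^+_{j+1/2})-\alpha(u^+_{j+1/2}-u^-_{j+1/2})\big]$. *Claim.* Let $u$ be smooth ($C^\infty$) near a point $x_0$ that is a critical point of order $n_{\mathrm{cp}}$, i.e. $u'(x_0)=\dots=u^{(n_{\mathrm{cp}})}(x_0)=0$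 and $u^{(n_{\mathrm{cp}}+1)}(x_0)\ne0$. Then for every type $i=1,\dots,5$ the WENO-MAIM$i$ scheme has the optimal order $2r-1$ near $x_0$: there are $K,\rho,h_0>0$, independent of $\epsilon$, such that for all $\epsilon\ge0$, all $0<h<h_0$ and all cells with $|x_j-x_0|\le\rho$, $$|u^{\pm}_{j+1/2}-u(x_{j+1/2})|\le Kh^{2r-1},\qquad \Big|\frac{\hat f_{j+1/2}-\hat f_{j-1/2}}{h}-\frac{f(u(x_{j+1/2}))-f(u(x_{j-1/2}))}{h}\Big|\le Kh^{2r-1}.$$ -/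

import Mathlib

noncomputable section

namespace WENO

/-! ### Linear reconstruction

Cells are labelled relative to a reference cell, which is scaled to `[-1/2, 1/2]`: cell `m : ℤ` is
`[m - 1/2, m + 1/2]`, and `v m` is the average over it. -/

/-- The polynomial of degree at most `N - 1` whose averages over the `N` consecutive cells
`a, a + 1, …, a + N - 1` are `v a, …, v (a + N - 1)`: the derivative of the polynomial of degree at
most `N` that interpolates the primitive `∑ v` at the `N + 1` cell interfaces. -/
def reconPoly (N : ℕ) (a : ℤ) (v : ℤ → ℝ) : Polynomial ℝ :=
  Polynomial.derivative
    (Lagrange.interpolate (Finset.range (N + 1))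
      (fun i : ℕ => (a : ℝ) - 1 / 2 + (i : ℝ))
      (fun i : ℕ => ∑ q ∈ Finset.range i, v (a + (q : ℤ))))

/-- The reconstruction polynomial on the substencil `s`, which consists of the `r` cells
`s - r + 1, …, s`. -/
def subPoly (r : ℕ) (s : Fin r) (v : ℤ → ℝ) : Polynomial ℝ :=
  reconPoly r ((s : ℤ) - (r : ℤ) + 1) v

/-- The `r`-th order approximation at the right interface of the reference cell. -/
def subValue (r : ℕ) (s : Fin r) (v : ℤ → ℝ) : ℝ :=
  (subPoly r s v).eval (1 / 2)

/-- The optimal (linear) weights `d_s`: the unique numbers for which `∑ s, d_s * subValue r s v` is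
the interface value of the reconstruction polynomial on all `2 r - 1` cells `-(r - 1), …, r - 1`.
For `r = 3` they are `1/10, 6/10, 3/10`. -/
def optWeight (r : ℕ) (s : Fin r) : ℝ :=
  (r.choose s : ℝ) * ((r - 1).choose s : ℝ) / ((2 * r - 1).choose r : ℝ)

/-! ### The Jiang–Shu weights -/

/-- The Jiang–Shu smoothness indicator
`β_s = ∑_{l=1}^{r-1} ∫_{I_j} Δx^(2l-1) (p_s^{(l)}(x))^2 dx`, written in the scaled variable
`ξ = (x - x_j) / Δx`, in which the powers of `Δx` cancel. -/
def smoothInd (r : ℕ) (v : ℤ → ℝ) (s : Fin r) : ℝ :=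
  ∑ l ∈ Finset.Icc 1 (r - 1),
    ∫ ξ in (-(1 / 2) : ℝ)..(1 / 2),
      ((Polynomial.derivative^[l] (subPoly r s v)).eval ξ) ^ 2

def alphaJS (r : ℕ) (ε : ℝ) (v : ℤ → ℝ) (s : Fin r) : ℝ :=
  optWeight r s / (ε + smoothInd r v s) ^ 2

def weightJS (r : ℕ) (ε : ℝ) (v : ℤ → ℝ) (s : Fin r) : ℝ :=
  alphaJS r ε v s / ∑ l, alphaJS r ε v l

/-! ### The modified adaptive improved mapping functions -/

/-- The smoothing approximation of the signum function. -/
def sg (k : ℕ) (δ x : ℝ) : ℝ :=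
  if δ ≤ |x| then x / |x| else x / ((δ ^ 2 - x ^ 2) ^ (k + 3) + |x|)

/-- `f_s^MAIM`, as a function of `ω`. -/
def fMAIM (k : ℕ) (A δ d ω : ℝ) : ℝ :=
  A * ((1 + (-1) ^ k) / 2 + (1 + (-1) ^ (k + 1)) / 2 * sg k δ (ω - d))

/-- The five types of adaptive control functions, with their parameters. -/
inductive AdaType (r : ℕ) : Type
  | type1 (m : Fin r → ℝ)
  | type2 (Q : ℝ) (CFS : Fin r → ℝ)
  | type3
  | type4
  | type5 (C : ℝ)

/-- The conditions on the parameters of the adaptive control functions. -/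
def AdaType.Admissible {r : ℕ} (k : ℕ) : AdaType r → Prop
  | .type1 m => ∀ s, 0 < m s
  | .type2 Q CFS => (k : ℝ)⁻¹ ≤ Q ∧ ∀ s, 0 < CFS s ∧ CFS s ≤ optWeight r s
  | .type3 => True
  | .type4 => True
  | .type5 C => 1 ≤ C

/-- The value of type 2. -/
def ada2 {r : ℕ} (k : ℕ) (Q : ℝ) (CFS : Fin r → ℝ) (s : Fin r) (ω : ℝ) : ℝ :=
  if CFS s < ω ∧ ω < 1 - (1 - optWeight r s) / optWeight r s * CFS s then 1 else Q * k

/-- The exponent `f_{i,s}^{Ada0}` of `ω`, given the indicators `β` and the weights `w`;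
here `ω = w s`. -/
def AdaType.exp0 {r : ℕ} (T : AdaType r) (k : ℕ) (εA : ℝ) (β w : Fin r → ℝ) (s : Fin r) : ℝ :=
  match T with
  | .type1 m => optWeight r s / (m s * w s + εA)
  | .type2 Q CFS => ada2 k Q CFS s (w s)
  | .type3 => (⨆ j, β j) / ((⨅ j, β j) + εA)
  | .type4 => (⨆ j, w j / optWeight r j) / ((⨅ j, w j / optWeight r j) + εA)
  | .type5 C => C

/-- The exponent `f_{i,s}^{Ada1}` of `1 - ω`. -/
def AdaType.exp1 {r : ℕ} (T : AdaType r) (k : ℕ) (εA : ℝ) (β w : Fin r → ℝ) (s : Fin r) : ℝ :=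
  match T with
  | .type1 m => (1 - optWeight r s) / (m s * (1 - w s) + εA)
  | .type2 Q CFS => ada2 k Q CFS s (w s)
  | .type3 => (⨆ j, β j) / ((⨅ j, β j) + εA)
  | .type4 => (⨆ j, w j / optWeight r j) / ((⨅ j, w j / optWeight r j) + εA)
  | .type5 C => C

/-- The mapping function with the exponents `e0 = f^{Ada0}` and `e1 = f^{Ada1}`. -/
def gMAIM (k : ℕ) (A δ d e0 e1 ω : ℝ) : ℝ :=
  d + fMAIM k A δ d ω * (ω - d) ^ (k + 1) /
    (fMAIM k A δ d ω * (ω - d) ^ k + ω ^ e0 * (1 - ω) ^ e1)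

/-- The parameters of a WENO-MAIM scheme: `k`, `A`, `δ`, the small constants `ε` (in the WENO-JS
weights) and `εA` (in the adaptive control functions), and the type `i` of the control functions
with its own parameters. -/
structure Params (r : ℕ) where
  k : ℕ
  A : ℝ
  δ : ℝ
  ε : ℝ
  εA : ℝ
  T : AdaType r

/-- The mapping function applied to the WENO-JS weight. -/
def alphaMAIM {r : ℕ} (P : Params r) (v : ℤ → ℝ) (s : Fin r) : ℝ :=
  gMAIM P.k P.A P.δ (optWeight r s)
    (P.T.exp0 P.k P.εA (smoothInd r v) (weightJS r P.ε v) s)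
    (P.T.exp1 P.k P.εA (smoothInd r v) (weightJS r P.ε v) s)
    (weightJS r P.ε v s)

def weightMAIM {r : ℕ} (P : Params r) (v : ℤ → ℝ) (s : Fin r) : ℝ :=
  alphaMAIM P v s / ∑ l, alphaMAIM P v l

/-- The WENO-MAIM value at the right interface of the reference cell. -/
def recon {r : ℕ} (P : Params r) (v : ℤ → ℝ) : ℝ :=
  ∑ s, weightMAIM P v s * subValue r s v

/-! ### The finite volume scheme on a uniform grid of mesh width `h` -/

/-- The average of `u` over the cell of width `h` with centre `x`. -/
def cellAvg (u : ℝ → ℝ) (h x : ℝ) : ℝ :=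
  (1 / h) * ∫ ξ in (x - h / 2)..(x + h / 2), u ξ

/-- `u_{j+1/2}^-`, where `x = x_j`: the reconstruction at `x_j + h/2` biased to the left. -/
def uMinus {r : ℕ} (P : Params r) (u : ℝ → ℝ) (h x : ℝ) : ℝ :=
  recon P (fun m : ℤ => cellAvg u h (x + m * h))

/-- `u_{j+1/2}^+`, where `x = x_j`: the mirror image, at the same interface, of the left-biased
reconstruction; it is centred at the cell `j + 1`. -/
def uPlus {r : ℕ} (P : Params r) (u : ℝ → ℝ) (h x : ℝ) : ℝ :=
  recon P (fun m : ℤ => cellAvg u h (x + (1 - m) * h))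

/-- The Lax–Friedrichs flux for the flux function `f`. -/
def fluxLF (f : ℝ → ℝ) (α a b : ℝ) : ℝ :=
  1 / 2 * (f a + f b - α * (b - a))

/-- The numerical flux at the right interface `x_{j+1/2} = x + h/2` of the cell with centre `x`. -/
def numFlux {r : ℕ} (P : Params r) (f : ℝ → ℝ) (α : ℝ) (u : ℝ → ℝ) (h x : ℝ) : ℝ :=
  fluxLF f α (uMinus P u h x) (uPlus P u h x)

/-- The spatial operator `-(f̂_{j+1/2} - f̂_{j-1/2}) / h` at the cell with centre `x`. -/
def spatialOp {r : ℕ} (P : Params r) (f : ℝ → ℝ) (α : ℝ) (u : ℝ → ℝ) (h x : ℝ) : ℝ :=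
  -(1 / h) * (numFlux P f α u h x - numFlux P f α u h (x - h))

/-- The exact time derivative of the cell average over the cell with centre `x`, for a solution
of `u_t + f(u)_x = 0` with profile `u` at the given time. -/
def exactOp (f u : ℝ → ℝ) (h x : ℝ) : ℝ :=
  -(1 / h) * (f (u (x + h / 2)) - f (u (x - h / 2)))

/-- `x₀` is a critical point of `u` of order `n`; order `0` means that `u' x₀ ≠ 0`. -/
def IsCritOrder (u : ℝ → ℝ) (x₀ : ℝ) (n : ℕ) : Prop :=
  (∀ i, 1 ≤ i → i ≤ n → iteratedDeriv i u x₀ = 0) ∧ iteratedDeriv (n + 1) u x₀ ≠ 0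

/-- The threshold `k^MAIM`. -/
def kMAIM (r n : ℕ) : ℝ :=
  (⌈(r : ℝ) / ((r : ℝ) - 1 - n) - 2⌉ : ℝ) +
    (1 + (-1 : ℝ) ^ ⌈(r : ℝ) / ((r : ℝ) - 1 - n) - 2⌉) / 2

end WENO

end

open scoped ContDiff

namespace WENO

open Polynomial Finset

/-! ### Linear reconstruction -/

/-! Fix a cell with centre `x` near `x₀`, in the scaled variable. Every substencil reproduces the
Taylor polynomial of degree less than `r`, so its data are those of one common polynomial plus a
perturbation `O(h ^ r)`. As the derivative of order `n + 1 < r` does not vanish, the indicator `B`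
of the common polynomial is at least a constant times `h ^ (2 (n + 1))`, and all indicators equal `B
(1 + O(h ^ p))` with `p = r - (n + 1)` (`JetOn.smoothInd_close`). Hence the Jiang–Shu weights are
`O(h ^ p)` from the optimal ones. Adding `ε ≥ 0` only shrinks the relative deviation, which is why
nothing depends on `ε` (`weightJS_close`).

The mapping functions have contact of order `q = mapOrder k` with the constant `d_s` at `d_s`
(`exists_gMAIM_close`), and the threshold on `k` says exactly enough to give `q p ≥ r`
(`le_mapOrder_mul`). So the final weights are `O(h ^ r)` from the optimal ones
(`JetOn.weightMAIM_close`). Multiplied by substencil errors `O(h ^ r)`, they change the linear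
scheme by `O(h ^ (2 r))` only.

The linear scheme is exact up to degree `2 r - 2` by a finite difference identity
(`sum_optWeight_mul_subValue`); its error is `κ u^(2r-1)(x) h ^ (2 r - 1) + O(h ^ (2 r))`. This
gives the order of the one-sided values. For the flux the division by `h` would cost one order, but
the leading coefficient is Lipschitz in `x`, so its difference between neighbouring interfaces
supplies the missing factor `h` (`abs_divided_difference_sub_le`). The right-biased value follows by
reflection. -/

lemma nodes_injOn (N : ℕ) (a : ℝ) :
    Set.InjOn (fun i : ℕ => a - 1 / 2 + (i : ℝ)) (range (N + 1)) := by
  intro i _ j _ hij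
  simpa using hij

/-- Reconstruction is exact on averages of polynomials of degree less than `N`, here given by a
primitive `Q` of degree at most `N`. -/
lemma interpolate_primitive_eq (N : ℕ) (a : ℤ) (Q : ℝ[X]) (hQ : Q.natDegree ≤ N) :
    Lagrange.interpolate (range (N + 1)) (fun i : ℕ => (a : ℝ) - 1 / 2 + (i : ℝ))
      (fun i : ℕ => ∑ q ∈ range i,
        (Q.eval (((a + (q : ℤ) : ℤ) : ℝ) + 1 / 2) - Q.eval (((a + (q : ℤ) : ℤ) : ℝ) - 1 / 2)))
      = Q - C (Q.eval ((a : ℝ) - 1 / 2)) := by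
  symm
  apply Lagrange.eq_interpolate_of_eval_eq _ (nodes_injOn N a)
  · rw [card_range]
    refine lt_of_le_of_lt degree_le_natDegree ?_
    rw [natDegree_sub_C]
    exact_mod_cast Nat.lt_succ_of_le hQ
  · intro i _
    have := sum_range_sub (fun q : ℕ => Q.eval ((a : ℝ) - 1 / 2 + q)) i
    simp only [Nat.cast_zero, add_zero] at this
    rw [eval_sub, eval_C, ← this]
    refine sum_congr rfl fun q _ => ?_
    push_cast
    congr 2 <;> ring

lemma reconPoly_primitive (N : ℕ) (a : ℤ) (Q : ℝ[X]) (hQ : Q.natDegree ≤ N) :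
    reconPoly N a (fun m : ℤ => Q.eval ((m : ℝ) + 1 / 2) - Q.eval ((m : ℝ) - 1 / 2))
      = derivative Q := by
  rw [reconPoly, interpolate_primitive_eq N a Q hQ]
  simp

/-- The Lagrange form separates the data from fixed polynomials; additivity, homogeneity and
stability are all read off from it. -/
lemma reconPoly_eq_sum (N : ℕ) (a : ℤ) (v : ℤ → ℝ) :
    reconPoly N a v = ∑ i ∈ range (N + 1), C (∑ q ∈ range i, v (a + (q : ℤ))) *
      derivative (Lagrange.basis (range (N + 1)) (fun i : ℕ => (a : ℝ) - 1 / 2 + (i : ℝ)) i) := by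
  rw [reconPoly, Lagrange.interpolate_apply, derivative_sum]
  simp [derivative_mul]

lemma reconPoly_add (N : ℕ) (a : ℤ) (v w : ℤ → ℝ) :
    reconPoly N a (fun m => v m + w m) = reconPoly N a v + reconPoly N a w := by
  simp only [reconPoly_eq_sum, sum_add_distrib, C_add, add_mul]

lemma exists_abs_eval_le (p : ℝ[X]) :
    ∃ K, 0 ≤ K ∧ ∀ ξ ∈ Set.Icc (-(1 / 2) : ℝ) (1 / 2), |p.eval ξ| ≤ K := by
  obtain ⟨K, hK⟩ := (isCompact_Icc (a := (-(1 / 2) : ℝ)) (b := 1 / 2)).exists_bound_of_continuousOn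
    p.continuous.continuousOn
  exact ⟨max K 0, le_max_right _ _, fun ξ hξ => (hK ξ hξ).trans (le_max_left _ _)⟩

/-- Stability: the reconstruction and its derivatives depend boundedly on the data. -/
lemma exists_reconPoly_bound (N : ℕ) (a : ℤ) (l : ℕ) :
    ∃ K, 0 ≤ K ∧ ∀ (e : ℤ → ℝ) (η : ℝ), (∀ m, a ≤ m → m < a + N → |e m| ≤ η) →
      ∀ ξ ∈ Set.Icc (-(1 / 2) : ℝ) (1 / 2),
        |(derivative^[l] (reconPoly N a e)).eval ξ| ≤ K * η := by
  choose B hB0 hB using fun i : ℕ => exists_abs_eval_le (derivative^[l] (derivative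
    (Lagrange.basis (range (N + 1)) (fun i : ℕ => (a : ℝ) - 1 / 2 + (i : ℝ)) i)))
  refine ⟨∑ i ∈ range (N + 1), i * B i, sum_nonneg fun i _ => mul_nonneg i.cast_nonneg (hB0 i),
    fun e η he ξ hξ => ?_⟩
  rw [reconPoly_eq_sum, iterate_derivative_sum, eval_finsetSum, sum_mul]
  refine (abs_sum_le_sum_abs _ _).trans (sum_le_sum fun i hi => ?_)
  rw [iterate_derivative_C_mul, eval_C_mul, abs_mul]
  have h1 : |∑ q ∈ range i, e (a + (q : ℤ))| ≤ i * η := by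
    refine (abs_sum_le_sum_abs _ _).trans ?_
    calc _ ≤ ∑ q ∈ range i, η := sum_le_sum fun q hq => he _ (by omega) (by
            rw [mem_range] at hi hq; omega)
      _ = i * η := by simp
  calc _ ≤ (i * η) * B i :=
        mul_le_mul h1 (hB i ξ hξ) (abs_nonneg _) ((abs_nonneg _).trans h1)
    _ = _ := by ring

/-- The right side does not involve `s`: this is why all indicators share one leading value. -/
lemma subPoly_primitive (r : ℕ) (s : Fin r) (Q : ℝ[X]) (hQ : Q.natDegree ≤ r) :
    subPoly r s (fun m : ℤ => Q.eval ((m : ℝ) + 1 / 2) - Q.eval ((m : ℝ) - 1 / 2))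
      = derivative Q := reconPoly_primitive _ _ Q hQ

lemma subPoly_add (r : ℕ) (s : Fin r) (v w : ℤ → ℝ) :
    subPoly r s (fun m => v m + w m) = subPoly r s v + subPoly r s w := reconPoly_add _ _ v w

lemma exists_subPoly_bound (r : ℕ) :
    ∃ K, 0 ≤ K ∧ ∀ (e : ℤ → ℝ) (η : ℝ), 0 ≤ η → (∀ m : ℤ, |m| ≤ r → |e m| ≤ η) →
      ∀ (s : Fin r) (l : ℕ), l < r → ∀ ξ ∈ Set.Icc (-(1 / 2) : ℝ) (1 / 2),
        |(derivative^[l] (subPoly r s e)).eval ξ| ≤ K * η := by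
  choose B hB0 hB using fun (s : Fin r) (l : ℕ) =>
    exists_reconPoly_bound r ((s : ℤ) - (r : ℤ) + 1) l
  refine ⟨∑ s, ∑ l ∈ range r, B s l, sum_nonneg fun s _ => sum_nonneg fun l _ => hB0 s l,
    fun e η hη he s l hl ξ hξ => ?_⟩
  refine (hB s l e η (fun m h1 h2 => he m ?_) ξ hξ).trans ?_
  · have := s.2
    rw [abs_le]
    constructor <;> omega
  · refine mul_le_mul_of_nonneg_right ?_ hη
    calc B s l ≤ ∑ l ∈ range r, B s l :=
          single_le_sum (f := fun l => B s l) (fun l _ => hB0 s l) (mem_range.2 hl)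
      _ ≤ _ := single_le_sum (f := fun s => ∑ l ∈ range r, B s l)
          (fun s _ => sum_nonneg fun l _ => hB0 s l) (mem_univ s)

/-! ### The optimal weights -/

lemma choose_two_mul_sub_one_pos {r : ℕ} (hr : 0 < r) : 0 < ((2 * r - 1).choose r : ℝ) := by
  exact_mod_cast Nat.choose_pos (by omega)

lemma optWeight_pos {r : ℕ} (s : Fin r) : 0 < optWeight r s := by
  have hs := s.2
  have h1 : 0 < (r.choose s : ℝ) := by exact_mod_cast Nat.choose_pos (by omega)
  have h2 : 0 < ((r - 1).choose s : ℝ) := by exact_mod_cast Nat.choose_pos (by omega)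
  exact div_pos (mul_pos h1 h2) (choose_two_mul_sub_one_pos (by omega))

/-- Vandermonde's identity for `(r - 1) + r` choose `r`; its last term vanishes because `r - 1 < r`.
-/
lemma sum_optWeight {r : ℕ} (hr : 0 < r) : ∑ s, optWeight r s = 1 := by
  have h : ((2 * r - 1).choose r : ℝ) = ∑ s ∈ range r, (r.choose s : ℝ) * ((r - 1).choose s) := by
    rw [show 2 * r - 1 = (r - 1) + r by omega, Nat.add_choose_eq,
      Nat.sum_antidiagonal_eq_sum_range_succ_mk, sum_range_succ,
      Nat.choose_eq_zero_of_lt (show r - 1 < r by omega)]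
    push_cast
    rw [zero_mul, add_zero]
    refine sum_congr rfl fun s hs => ?_
    rw [Nat.choose_symm (by rw [mem_range] at hs; omega), mul_comm]
  simp only [optWeight]
  rw [← sum_div, Fin.sum_univ_eq_sum_range (fun s => (r.choose s : ℝ) * ((r - 1).choose s)), ← h]
  exact div_self (choose_two_mul_sub_one_pos hr).ne'

lemma optWeight_lt_one {r : ℕ} (hr : 2 ≤ r) (s : Fin r) : optWeight r s < 1 := by
  rw [← sum_optWeight (r := r) (by omega)]
  have : Nontrivial (Fin r) := Fin.nontrivial_iff_two_le.2 hr
  obtain ⟨t, ht⟩ := exists_ne s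
  exact single_lt_sum ht (mem_univ s) (mem_univ t) (optWeight_pos t)
    fun j _ _ => (optWeight_pos j).le

/-- The difference quotient at `1 / 2` of a polynomial, as a polynomial in the increment. -/
noncomputable def slopePoly (Q : ℝ[X]) : ℝ[X] := (Q.comp (X + C (1 / 2))).divX

lemma slopePoly_eval_mul (Q : ℝ[X]) (y : ℝ) :
    (slopePoly Q).eval y * y = Q.eval (y + 1 / 2) - Q.eval (1 / 2) := by
  have h := congrArg (eval y) (divX_mul_X_add (Q.comp (X + C (1 / 2))))
  have h0 : (Q.comp (X + C (1 / 2))).coeff 0 = Q.eval (1 / 2) := by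
    rw [coeff_zero_eq_eval_zero, eval_comp]; simp
  rw [eval_add, eval_mul, eval_X, eval_C, h0, eval_comp, eval_add, eval_X, eval_C] at h
  rw [slopePoly]
  linarith

lemma slopePoly_eval_zero (Q : ℝ[X]) : (slopePoly Q).eval 0 = (derivative Q).eval (1 / 2) := by
  have h : (derivative (Q.comp (X + C (1 / 2)))).eval 0 = (derivative Q).eval (1 / 2) := by
    rw [derivative_comp]; simp [eval_comp]
  rw [← h, slopePoly, ← coeff_zero_eq_eval_zero, ← coeff_zero_eq_eval_zero, coeff_divX,
    coeff_derivative]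
  simp

lemma slopePoly_sub (Q S : ℝ[X]) : slopePoly (Q - S) = slopePoly Q - slopePoly S := by
  ext i
  simp [slopePoly, coeff_divX, sub_comp]

lemma natDegree_slopePoly (Q : ℝ[X]) : (slopePoly Q).natDegree = Q.natDegree - 1 := by
  rw [slopePoly, natDegree_divX_eq_natDegree_tsub_one, natDegree_comp]
  rw [natDegree_X_add_C, mul_one]

/-- The error of the derivative at the node `1 / 2` of an interpolation on `r + 1` equidistant
nodes, as a forward difference. -/
lemma fwdDiff_slopePoly {r : ℕ} (s : ℕ) (hs : s < r) (Q S : ℝ[X])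
    (hS : S.natDegree ≤ r) (c : ℝ)
    (h : ∀ i ≤ r, S.eval (((s : ℝ) - r + i) + 1 / 2) = Q.eval (((s : ℝ) - r + i) + 1 / 2) - c) :
    ((fwdDiff (1 : ℝ))^[r] (slopePoly Q).eval) ((s : ℝ) - r) =
      (-1) ^ s * (r.choose s) * ((derivative Q).eval (1 / 2) - (derivative S).eval (1 / 2)) := by
  -- The slope of `S` has degree less than `r`, so an `r`-th difference does not see it.
  have hS0 : (fwdDiff (1 : ℝ))^[r] (slopePoly S).eval = 0 :=
    Polynomial.fwdDiff_iter_eq_zero_of_degree_lt (by rw [natDegree_slopePoly]; omega)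
  have hsplit : (slopePoly Q).eval = (slopePoly (Q - S)).eval + (slopePoly S).eval := by
    funext y; simp [slopePoly_sub]
  rw [hsplit, fwdDiff_iter_add, hS0, add_zero, fwdDiff_iter_eq_sum_shift]
  have h0 : (Q - S).eval (1 / 2) = c := by
    have := h (r - s) (by omega)
    rw [Nat.cast_sub hs.le, show ((s : ℝ) - r + (r - s)) + 1 / 2 = 1 / 2 by ring] at this
    rw [eval_sub, this]; ring
  -- `Q - S` takes the value `c` at every node, so its slope vanishes at all of them except the base
  -- node, `i = r - s`, where it is the derivative.
  rw [sum_eq_single (r - s)]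
  · rw [Nat.sub_sub_self hs.le, Nat.choose_symm hs.le, nsmul_one, Nat.cast_sub hs.le,
      show (s : ℝ) - r + (r - s) = 0 by ring, slopePoly_eval_zero, derivative_sub, eval_sub]
    simp
  · intro i hi hne
    have hi' : i ≤ r := by rw [mem_range] at hi; omega
    have hy : (s : ℝ) - r + i ≠ 0 := by
      intro h0
      have : (s : ℝ) + i = r := by linarith
      have : s + i = r := by exact_mod_cast this
      omega
    have := slopePoly_eval_mul (Q - S) ((s : ℝ) - r + i)
    rw [h0, eval_sub, h i hi', sub_sub_cancel, sub_self] at this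
    rw [nsmul_one, (mul_eq_zero.1 this).resolve_right hy, smul_zero]
  · intro hmem
    exact absurd (mem_range.2 (by omega)) hmem

/-- The optimal combination of the substencil values is exact up to degree `2 r - 2`. -/
lemma sum_optWeight_mul_subValue {r : ℕ} (hr : 0 < r) (Q : ℝ[X]) (hQ : Q.natDegree ≤ 2 * r - 1) :
    ∑ s, optWeight r s *
      subValue r s (fun m : ℤ => Q.eval ((m : ℝ) + 1 / 2) - Q.eval ((m : ℝ) - 1 / 2))
      = (derivative Q).eval (1 / 2) := by
  set v : ℤ → ℝ := fun m : ℤ => Q.eval ((m : ℝ) + 1 / 2) - Q.eval ((m : ℝ) - 1 / 2) with hv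
  -- The interpolated primitive starts at zero on the leftmost interface, so it matches `Q` up to
  -- the constant `Q (s - r + 1/2)`.
  have key : ∀ s : Fin r, (-1) ^ (s : ℕ) * (r.choose s) *
      ((derivative Q).eval (1 / 2) - subValue r s v) =
      ((fwdDiff (1 : ℝ))^[r] (slopePoly Q).eval) ((s : ℝ) - r) := by
    intro s
    rw [fwdDiff_slopePoly s s.2 Q
      (Lagrange.interpolate (range (r + 1))
        (fun i : ℕ => (((s : ℤ) - (r : ℤ) + 1 : ℤ) : ℝ) - 1 / 2 + (i : ℝ))
        (fun i : ℕ => ∑ q ∈ range i, v (((s : ℤ) - (r : ℤ) + 1) + (q : ℤ))))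
      ?_ (Q.eval (((s : ℝ) - r) + 1 / 2)) ?_]
    · rfl
    · have := Lagrange.degree_interpolate_le
        (fun i : ℕ => ∑ q ∈ range i, v (((s : ℤ) - (r : ℤ) + 1) + (q : ℤ)))
        (nodes_injOn r (((s : ℤ) - (r : ℤ) + 1 : ℤ) : ℝ))
      rw [card_range] at this
      exact natDegree_le_of_degree_le this
    · intro i hi
      have := Lagrange.eval_interpolate_at_node
        (fun i : ℕ => ∑ q ∈ range i, v (((s : ℤ) - (r : ℤ) + 1) + (q : ℤ)))
        (nodes_injOn r (((s : ℤ) - (r : ℤ) + 1 : ℤ) : ℝ)) (mem_range.2 (Nat.lt_succ_of_le hi))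
      have hnode : (((s : ℤ) - (r : ℤ) + 1 : ℤ) : ℝ) - 1 / 2 + (i : ℝ)
          = ((s : ℝ) - r + i) + 1 / 2 := by push_cast; ring
      simp only [hnode] at this
      rw [this]
      have htel := sum_range_sub (fun q : ℕ => Q.eval (((s : ℝ) - r + q) + 1 / 2)) i
      simp only [Nat.cast_zero, add_zero] at htel
      rw [← htel]
      refine sum_congr rfl fun q _ => ?_
      simp only [hv]
      push_cast
      congr 2 <;> ring
  -- The slope has degree at most `2 r - 2`. Expanding only the outer `r - 1` differences at `-r`
  -- gives a vanishing combination of the substencil errors, and its binomials times those in `key`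
  -- are the numerators of the optimal weights.
  have hzero : (fwdDiff (1 : ℝ))^[(r - 1) + r] (slopePoly Q).eval = 0 :=
    Polynomial.fwdDiff_iter_eq_zero_of_degree_lt (by rw [natDegree_slopePoly]; omega)
  have hz := congrFun hzero (-(r : ℝ))
  rw [Function.iterate_add_apply, fwdDiff_iter_eq_sum_shift, Nat.sub_add_cancel hr] at hz
  have hsum : ∑ s : Fin r, ((r - 1).choose s : ℝ) * (-1) ^ (s : ℕ) *
      ((fwdDiff (1 : ℝ))^[r] (slopePoly Q).eval) ((s : ℝ) - r) = 0 := by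
    rw [Fin.sum_univ_eq_sum_range (fun s => ((r - 1).choose s : ℝ) * (-1) ^ s *
      ((fwdDiff (1 : ℝ))^[r] (slopePoly Q).eval) ((s : ℝ) - r)) r]
    have := congrArg (fun z => (-1 : ℝ) ^ (r - 1) * z) hz
    simp only [Pi.zero_apply, mul_zero, mul_sum] at this
    rw [← this]
    refine sum_congr rfl fun s hs => ?_
    rw [mem_range] at hs
    have hp : (-1 : ℝ) ^ (r - 1) * (-1) ^ (r - 1 - s) = (-1) ^ s := by
      rw [← pow_add, show r - 1 + (r - 1 - s) = 2 * (r - 1 - s) + s by omega, pow_add, pow_mul]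
      simp
    rw [zsmul_eq_mul, nsmul_one, ← hp, show -(r : ℝ) + s = (s : ℝ) - r by ring]
    push_cast
    ring
  have hdiff : ∑ s, optWeight r s * ((derivative Q).eval (1 / 2) - subValue r s v) = 0 := by
    have : ∀ s : Fin r, optWeight r s * ((derivative Q).eval (1 / 2) - subValue r s v) =
        ((2 * r - 1).choose r : ℝ)⁻¹ * (((r - 1).choose s : ℝ) * (-1) ^ (s : ℕ) *
          ((fwdDiff (1 : ℝ))^[r] (slopePoly Q).eval) ((s : ℝ) - r)) := by
      intro s
      have hp : (-1 : ℝ) ^ (s : ℕ) * (-1) ^ (s : ℕ) = 1 := by rw [← mul_pow]; simp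
      rw [← key s, optWeight, div_eq_inv_mul]
      linear_combination (-((2 * r - 1).choose r : ℝ)⁻¹ * (r.choose s) * ((r - 1).choose s) *
        ((derivative Q).eval (1 / 2) - subValue r s v)) * hp
    rw [sum_congr rfl fun s _ => this s, ← mul_sum, hsum, mul_zero]
  simp only [mul_sub, sum_sub_distrib, ← sum_mul, sum_optWeight hr, one_mul] at hdiff
  linarith

end WENO
namespace WENO

open Polynomial Finset

/-! ### Taylor expansions of the cell averages -/

/-- On the ball of radius `R` around `x₀`, the derivatives of `u` up to order `N` exist and are
bounded by `M`. -/
structure JetOn (u : ℝ → ℝ) (x₀ R M : ℝ) (N : ℕ) : Prop where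
  hasDerivAt : ∀ l < N, ∀ y, |y - x₀| < R →
    HasDerivAt (iteratedDeriv l u) (iteratedDeriv (l + 1) u y) y
  bound : ∀ l ≤ N, ∀ y, |y - x₀| < R → |iteratedDeriv l u y| ≤ M

lemma contDiffAt_iteratedDeriv {u : ℝ → ℝ} {x₀ : ℝ} (hu : ContDiffAt ℝ ∞ u x₀) (l : ℕ) :
    ContDiffAt ℝ ∞ (iteratedDeriv l u) x₀ := by
  induction l with
  | zero => simpa using hu
  | succ l ih => rw [iteratedDeriv_succ]; exact ih.derivWithin le_rfl

lemma exists_jetOn {u : ℝ → ℝ} {x₀ : ℝ} (hu : ContDiffAt ℝ ∞ u x₀) (N : ℕ) :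
    ∃ R > 0, ∃ M > 0, JetOn u x₀ R M N := by
  have hd : ∀ l : ℕ, ∀ᶠ y in nhds x₀,
      HasDerivAt (iteratedDeriv l u) (iteratedDeriv (l + 1) u y) y := by
    intro l
    have h1 : ContDiffAt ℝ 1 (iteratedDeriv l u) x₀ :=
      (contDiffAt_iteratedDeriv hu l).of_le (by exact_mod_cast le_top)
    filter_upwards [h1.eventually (by simp)] with y hy
    rw [iteratedDeriv_succ]
    exact (hy.differentiableAt (by simp)).hasDerivAt
  have hb : ∀ l : ℕ, ∀ᶠ y in nhds x₀, |iteratedDeriv l u y| < |iteratedDeriv l u x₀| + 1 := by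
    intro l
    exact ((contDiffAt_iteratedDeriv hu l).continuousAt.abs).eventually
      (gt_mem_nhds (lt_add_one _))
  have hall : ∀ᶠ y in nhds x₀, ∀ l ∈ range (N + 1),
      HasDerivAt (iteratedDeriv l u) (iteratedDeriv (l + 1) u y) y ∧
        |iteratedDeriv l u y| < |iteratedDeriv l u x₀| + 1 :=
    (Filter.eventually_all_finset _).2 fun l _ => (hd l).and (hb l)
  obtain ⟨R, hR, hRb⟩ := Metric.eventually_nhds_iff.1 hall
  refine ⟨R, hR, ∑ l ∈ range (N + 1), (|iteratedDeriv l u x₀| + 1), ?_, ?_, ?_⟩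
  · exact sum_pos (fun l _ => by positivity) ⟨0, by simp⟩
  · intro l hl y hy
    exact (hRb (by simpa [Real.dist_eq] using hy) l (mem_range.2 (by omega))).1
  · intro l hl y hy
    refine (hRb (by simpa [Real.dist_eq] using hy) l (mem_range.2 (by omega))).2.le.trans ?_
    exact single_le_sum (f := fun l => |iteratedDeriv l u x₀| + 1)
      (fun l _ => by positivity) (mem_range.2 (by omega))

/-- Induction by the mean value inequality: the derivative of the remainder of `D 0` is the
remainder of `D 1`. A general family `D` allows this shift. -/
lemma taylor_bound (x₀ R M : ℝ) (N : ℕ) (D : ℕ → ℝ → ℝ)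
    (hD : ∀ l < N, ∀ y, |y - x₀| < R → HasDerivAt (D l) (D (l + 1) y) y)
    (hM : ∀ y, |y - x₀| < R → |D N y| ≤ M) (x y : ℝ) (hx : |x - x₀| < R) (hy : |y - x₀| < R) :
    |D 0 y - ∑ l ∈ range N, D l x * (y - x) ^ l / l.factorial| ≤ M * |y - x| ^ N := by
  induction N generalizing D y with
  | zero => simpa using hM y hy
  | succ N ih =>
    have hsub : ∀ z ∈ Set.uIcc x y, |z - x₀| < R := by
      intro z hz
      have hb : Set.uIcc x y ⊆ Metric.ball x₀ R :=
        ((convex_ball x₀ R).ordConnected).uIcc_subset (by simpa [Real.dist_eq] using hx)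
          (by simpa [Real.dist_eq] using hy)
      simpa [Real.dist_eq] using hb hz
    have hder : ∀ z ∈ Set.uIcc x y, HasDerivWithinAt
        (fun z => D 0 z - ∑ l ∈ range (N + 1), D l x * (z - x) ^ l / l.factorial)
        (D 1 z - ∑ l ∈ range N, D (l + 1) x * (z - x) ^ l / l.factorial) (Set.uIcc x y) z := by
      intro z hz
      refine HasDerivAt.hasDerivWithinAt ?_
      refine (hD 0 (by omega) z (hsub z hz)).sub ?_
      have hs : ∀ l ∈ range (N + 1), HasDerivAt (fun z => D l x * (z - x) ^ l / l.factorial)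
          (D l x * (l * (z - x) ^ (l - 1)) / l.factorial) z := by
        intro l _
        have := (((hasDerivAt_id z).sub_const x).pow l).const_mul (D l x)
        have := this.div_const (l.factorial : ℝ)
        simpa using this
      have h2 := HasDerivAt.fun_sum hs
      convert h2 using 1
      rw [sum_range_succ']
      simp only [Nat.cast_zero, zero_mul, mul_zero, zero_div, add_zero, Nat.add_sub_cancel]
      refine sum_congr rfl fun l _ => ?_
      rw [Nat.factorial_succ]
      push_cast
      have : (l.factorial : ℝ) ≠ 0 := by exact_mod_cast l.factorial_ne_zero
      field_simp
    have hbd : ∀ z ∈ Set.uIcc x y,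
        ‖D 1 z - ∑ l ∈ range N, D (l + 1) x * (z - x) ^ l / l.factorial‖ ≤ M * |y - x| ^ N := by
      intro z hz
      refine (ih (fun l => D (l + 1)) (fun l hl w hw => hD (l + 1) (by omega) w hw) hM z
        (hsub z hz)).trans ?_
      have hM0 : 0 ≤ M := (abs_nonneg _).trans (hM x hx)
      have := Set.abs_sub_left_of_mem_uIcc hz
      gcongr
    have := Convex.norm_image_sub_le_of_norm_hasDerivWithin_le hder hbd (convex_uIcc x y)
      Set.left_mem_uIcc Set.right_mem_uIcc
    have h0 : D 0 x - ∑ l ∈ range (N + 1), D l x * (x - x) ^ l / l.factorial = 0 := by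
      rw [sum_range_succ']
      simp
    simp only [h0, sub_zero, Real.norm_eq_abs] at this
    rw [pow_succ, ← mul_assoc]
    exact this

/-- The primitive of the polynomial `∑ l < N, c l * ξ ^ l / l!`. -/
noncomputable def primPoly (c : ℕ → ℝ) (N : ℕ) : ℝ[X] :=
  ∑ l ∈ range N, C (c l / (l + 1).factorial) * X ^ (l + 1)

lemma natDegree_primPoly_le (c : ℕ → ℝ) (N : ℕ) : (primPoly c N).natDegree ≤ N := by
  refine natDegree_sum_le_of_forall_le _ _ fun l hl => ?_
  rw [mem_range] at hl
  exact (natDegree_C_mul_X_pow_le _ _).trans hl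

lemma primPoly_succ (c : ℕ → ℝ) (N : ℕ) :
    primPoly c (N + 1) = primPoly c N + C (c N / (N + 1).factorial) * X ^ (N + 1) := by
  rw [primPoly, sum_range_succ, primPoly]

lemma derivative_primPoly (c : ℕ → ℝ) (N : ℕ) :
    derivative (primPoly c N) = ∑ l ∈ range N, C (c l / l.factorial) * X ^ l := by
  rw [primPoly, derivative_sum]
  refine sum_congr rfl fun l _ => ?_
  rw [derivative_C_mul_X_pow, Nat.add_sub_cancel, Nat.factorial_succ]
  congr 2
  push_cast
  have : (l.factorial : ℝ) ≠ 0 := by exact_mod_cast l.factorial_ne_zero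
  field_simp

lemma eval_derivative_primPoly (c : ℕ → ℝ) (N : ℕ) (ξ : ℝ) :
    (derivative (primPoly c N)).eval ξ = ∑ l ∈ range N, c l * ξ ^ l / l.factorial := by
  rw [derivative_primPoly, eval_finsetSum]
  refine sum_congr rfl fun l _ => ?_
  rw [eval_C_mul, eval_pow, eval_X]
  ring

/-- The derivatives of `ξ ↦ u (x + h * ξ)` at `0`. -/
noncomputable def scaledJet (u : ℝ → ℝ) (h x : ℝ) (l : ℕ) : ℝ := iteratedDeriv l u x * h ^ l

lemma JetOn.taylor_scaled {u : ℝ → ℝ} {x₀ R M : ℝ} {N : ℕ} (hJ : JetOn u x₀ R M N) {S h x ξ : ℝ}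
    (hS : |ξ| ≤ S) (hh : 0 < h) (hx : |x - x₀| + S * h < R) :
    |u (x + h * ξ) - (derivative (primPoly (scaledJet u h x) N)).eval ξ| ≤ M * S ^ N * h ^ N := by
  have hS0 : 0 ≤ S := (abs_nonneg _).trans hS
  have hx' : |x - x₀| < R := by nlinarith
  have hle : |h * ξ| ≤ S * h := by
    rw [abs_mul, abs_of_pos hh, mul_comm]; gcongr
  have hy : |x + h * ξ - x₀| < R := by
    calc |x + h * ξ - x₀| = |(x - x₀) + h * ξ| := by ring_nf
      _ ≤ |x - x₀| + |h * ξ| := abs_add_le _ _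
      _ < R := by linarith
  have h0 := taylor_bound x₀ R M N (fun l => iteratedDeriv l u) hJ.hasDerivAt
    (hJ.bound N le_rfl) x (x + h * ξ) hx' hy
  have hM0 : 0 ≤ M := (abs_nonneg _).trans (hJ.bound N le_rfl x hx')
  rw [eval_derivative_primPoly]
  simp only [iteratedDeriv_zero, add_sub_cancel_left] at h0
  have heq : ∑ l ∈ range N, scaledJet u h x l * ξ ^ l / l.factorial
      = ∑ l ∈ range N, iteratedDeriv l u x * (h * ξ) ^ l / l.factorial := by
    refine sum_congr rfl fun l _ => ?_
    rw [scaledJet, mul_pow]; ring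
  rw [heq]
  refine h0.trans ?_
  rw [mul_assoc, ← mul_pow]
  gcongr

lemma cellAvg_eq_integral (u : ℝ → ℝ) {h : ℝ} (hh : 0 < h) (x m : ℝ) :
    cellAvg u h (x + m * h) = ∫ ξ in (m - 1 / 2)..(m + 1 / 2), u (x + h * ξ) := by
  rw [intervalIntegral.integral_comp_add_mul _ hh.ne', cellAvg, smul_eq_mul, one_div]
  congr 2 <;> ring

lemma JetOn.continuousAt {u : ℝ → ℝ} {x₀ R M : ℝ} {N : ℕ} (hJ : JetOn u x₀ R M N) (hN : 0 < N)
    {y : ℝ} (hy : |y - x₀| < R) : ContinuousAt u y := by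
  have := (hJ.hasDerivAt 0 hN y hy).continuousAt
  rwa [iteratedDeriv_zero] at this

/-- The cell averages agree with those of the Taylor polynomial of degree less than `N` up to
`O(h ^ N)`. -/
lemma JetOn.cellAvg_sub_le {u : ℝ → ℝ} {x₀ R M : ℝ} {N : ℕ} (hJ : JetOn u x₀ R M N) (hN : 0 < N)
    {r : ℕ} {h x : ℝ} (hh : 0 < h) (hx : |x - x₀| + (r + 1) * h < R) {m : ℤ} (hm : |m| ≤ r) :
    |cellAvg u h (x + m * h) - ((primPoly (scaledJet u h x) N).eval ((m : ℝ) + 1 / 2) -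
      (primPoly (scaledJet u h x) N).eval ((m : ℝ) - 1 / 2))| ≤ M * (r + 1) ^ N * h ^ N := by
  set Q := primPoly (scaledJet u h x) N
  have hQ : ∫ ξ in ((m : ℝ) - 1 / 2)..((m : ℝ) + 1 / 2), (derivative Q).eval ξ
      = Q.eval ((m : ℝ) + 1 / 2) - Q.eval ((m : ℝ) - 1 / 2) :=
    intervalIntegral.integral_eq_sub_of_hasDerivAt (fun ξ _ => Q.hasDerivAt ξ)
      ((derivative Q).continuous.intervalIntegrable _ _)
  have hle : (m : ℝ) - 1 / 2 ≤ m + 1 / 2 := by linarith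
  have hmr : |(m : ℝ)| ≤ r := by exact_mod_cast hm
  have hξ : ∀ ξ ∈ Set.uIcc ((m : ℝ) - 1 / 2) (m + 1 / 2), |ξ| ≤ (r : ℝ) + 1 := by
    intro ξ hξ
    rw [Set.uIcc_of_le hle, Set.mem_Icc] at hξ
    rw [abs_le] at hmr ⊢
    constructor <;> linarith [hξ.1, hξ.2, hmr.1, hmr.2]
  have hcont : IntervalIntegrable (fun ξ => u (x + h * ξ)) MeasureTheory.volume
      ((m : ℝ) - 1 / 2) (m + 1 / 2) := by
    refine ContinuousOn.intervalIntegrable fun ξ hmem => ContinuousAt.continuousWithinAt ?_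
    have hy : |x + h * ξ - x₀| < R := by
      have : |h * ξ| ≤ (r + 1) * h := by
        rw [abs_mul, abs_of_pos hh, mul_comm]; gcongr; exact hξ ξ hmem
      calc |x + h * ξ - x₀| = |(x - x₀) + h * ξ| := by ring_nf
        _ ≤ |x - x₀| + |h * ξ| := abs_add_le _ _
        _ < R := by linarith
    exact ContinuousAt.comp (f := fun ξ => x + h * ξ) (hJ.continuousAt hN hy) (by fun_prop)
  rw [cellAvg_eq_integral u hh, ← hQ, ← intervalIntegral.integral_sub hcont
    ((derivative Q).continuous.intervalIntegrable _ _)]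
  have := intervalIntegral.norm_integral_le_of_norm_le_const
    (C := M * (r + 1) ^ N * h ^ N) (a := (m : ℝ) - 1 / 2) (b := m + 1 / 2)
    (f := fun ξ => u (x + h * ξ) - (derivative Q).eval ξ)
    (fun ξ hmem => hJ.taylor_scaled (hξ ξ (Set.uIoc_subset_uIcc hmem)) hh hx)
  rwa [show (m : ℝ) + 1 / 2 - (m - 1 / 2) = 1 by ring, abs_one, mul_one, Real.norm_eq_abs] at this

end WENO
namespace WENO

open Polynomial Finset

/-! ### The smoothness indicators near a critical point -/

lemma JetOn.mono {u : ℝ → ℝ} {x₀ R M : ℝ} {N N' : ℕ} (hJ : JetOn u x₀ R M N) (h : N' ≤ N) :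
    JetOn u x₀ R M N' :=
  ⟨fun l hl => hJ.hasDerivAt l (by omega), fun l hl => hJ.bound l (by omega)⟩

/-- With the factorials in the coefficients, differentiation is a shift of the jet. -/
lemma iterate_derivative_primPoly (c : ℕ → ℝ) (N k : ℕ) :
    derivative^[k] (derivative (primPoly c (N + k))) =
      derivative (primPoly (fun l => c (l + k)) N) := by
  induction k generalizing c with
  | zero => rfl
  | succ k ih =>
    have h : derivative (derivative (primPoly c (N + k + 1))) =
        derivative (primPoly (fun l => c (l + 1)) (N + k)) := by
      rw [derivative_primPoly c, sum_range_succ', primPoly]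
      simp
    rw [Function.iterate_succ_apply, ← add_assoc, h, ih]
    simp only [add_assoc]

/-- The value of the smoothness indicators on a polynomial. -/
noncomputable def polyInd (r : ℕ) (p : ℝ[X]) : ℝ :=
  ∑ l ∈ Icc 1 (r - 1), ∫ ξ in (-(1 / 2) : ℝ)..(1 / 2), ((derivative^[l] p).eval ξ) ^ 2

/-- Young's inequality for the cross term `2 a e`; the free parameter `η` later becomes the relative
error of the indicators. -/
lemma abs_sq_add_sub_sq_le (a e : ℝ) {η : ℝ} (hη : 0 < η) :
    |(a + e) ^ 2 - a ^ 2| ≤ η * a ^ 2 + (η⁻¹ + 1) * e ^ 2 := by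
  have h : 0 ≤ η⁻¹ * (η * a - e) ^ 2 := by positivity
  have h' : 0 ≤ η⁻¹ * (η * a + e) ^ 2 := by positivity
  have e1 : η⁻¹ * (η * a - e) ^ 2 = η * a ^ 2 - 2 * a * e + η⁻¹ * e ^ 2 := by field_simp; ring
  have e2 : η⁻¹ * (η * a + e) ^ 2 = η * a ^ 2 + 2 * a * e + η⁻¹ * e ^ 2 := by field_simp; ring
  rw [abs_le]
  constructor <;> nlinarith [sq_nonneg e]

lemma polyInd_add_sub_le (r : ℕ) (p q : ℝ[X]) {η κ : ℝ} (hη : 0 < η)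
    (hq : ∀ l < r, ∀ ξ ∈ Set.Icc (-(1 / 2) : ℝ) (1 / 2), |(derivative^[l] q).eval ξ| ≤ κ) :
    |polyInd r (p + q) - polyInd r p| ≤ η * polyInd r p + r * ((η⁻¹ + 1) * κ ^ 2) := by
  have hint : ∀ l ∈ Icc 1 (r - 1),
      |(∫ ξ in (-(1 / 2) : ℝ)..(1 / 2), ((derivative^[l] (p + q)).eval ξ) ^ 2) -
        ∫ ξ in (-(1 / 2) : ℝ)..(1 / 2), ((derivative^[l] p).eval ξ) ^ 2| ≤
      η * (∫ ξ in (-(1 / 2) : ℝ)..(1 / 2), ((derivative^[l] p).eval ξ) ^ 2) +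
        (η⁻¹ + 1) * κ ^ 2 := by
    intro l hl
    rw [mem_Icc] at hl
    have hc : ∀ p : ℝ[X], IntervalIntegrable (fun ξ => (p.eval ξ) ^ 2) MeasureTheory.volume
        (-(1 / 2) : ℝ) (1 / 2) := fun p => (p.continuous.pow 2).intervalIntegrable _ _
    rw [← intervalIntegral.integral_sub (hc _) (hc _), ← intervalIntegral.integral_const_mul]
    have hconst : (η⁻¹ + 1) * κ ^ 2 = ∫ _ in (-(1 / 2) : ℝ)..(1 / 2), (η⁻¹ + 1) * κ ^ 2 := by
      rw [intervalIntegral.integral_const, smul_eq_mul]; ring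
    rw [hconst, ← intervalIntegral.integral_add ((hc _).const_mul _) (by simp)]
    refine (intervalIntegral.abs_integral_le_integral_abs (by norm_num)).trans ?_
    refine intervalIntegral.integral_mono_on (by norm_num) ((hc _).sub (hc _)).abs
      (((hc _).const_mul _).add (by simp)) fun ξ hξ => ?_
    rw [iterate_map_add, eval_add]
    refine (abs_sq_add_sub_sq_le _ _ hη).trans ?_
    have := hq l (by omega) ξ hξ
    have h2 : ((derivative^[l] q).eval ξ) ^ 2 ≤ κ ^ 2 := sq_le_sq.2 (this.trans (le_abs_self κ))
    gcongr
  rw [polyInd, polyInd, ← sum_sub_distrib]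
  refine (abs_sum_le_sum_abs _ _).trans ((sum_le_sum hint).trans ?_)
  rw [sum_add_distrib, ← mul_sum, sum_const, Nat.card_Icc, nsmul_eq_mul, Nat.add_sub_cancel]
  have : 0 ≤ (η⁻¹ + 1) * κ ^ 2 := by positivity
  gcongr
  omega

lemma le_polyInd {r k : ℕ} (hk1 : 1 ≤ k) (hk : k < r) (p : ℝ[X]) {b : ℝ} (hb : 0 ≤ b)
    (h : ∀ ξ ∈ Set.Icc (-(1 / 2) : ℝ) (1 / 2), b ≤ |(derivative^[k] p).eval ξ|) :
    b ^ 2 ≤ polyInd r p := by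
  have h1 : b ^ 2 ≤ ∫ ξ in (-(1 / 2) : ℝ)..(1 / 2), ((derivative^[k] p).eval ξ) ^ 2 := by
    have hconst : b ^ 2 = ∫ _ in (-(1 / 2) : ℝ)..(1 / 2), b ^ 2 := by
      rw [intervalIntegral.integral_const, smul_eq_mul]; ring
    rw [hconst]
    refine intervalIntegral.integral_mono_on (by norm_num) (by simp)
      (((derivative^[k] p).continuous.pow 2).intervalIntegrable _ _) fun ξ hξ => ?_
    rw [← sq_abs ((derivative^[k] p).eval ξ)]
    exact pow_le_pow_left₀ hb (h ξ hξ) 2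
  refine h1.trans ?_
  exact single_le_sum (f := fun l => ∫ ξ in (-(1 / 2) : ℝ)..(1 / 2),
    ((derivative^[l] p).eval ξ) ^ 2)
    (fun l _ => intervalIntegral.integral_nonneg (by norm_num) fun ξ _ => sq_nonneg _)
    (mem_Icc.2 ⟨hk1, by omega⟩)

/-- A nonvanishing derivative of order `k` bounds the `k`-th derivative of the scaled Taylor
polynomial from below. -/
lemma JetOn.le_iterate_derivative {u : ℝ → ℝ} {x₀ R M c₀ : ℝ} {r k : ℕ} (hJ : JetOn u x₀ R M r)
    (hk : k < r) {h x : ℝ} (hh : 0 < h) (hh1 : h ≤ 1) (hx : |x - x₀| < R)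
    (hc : c₀ ≤ |iteratedDeriv k u x|) (hsmall : r * M * h ≤ c₀ / 2)
    (ξ : ℝ) (hξ : ξ ∈ Set.Icc (-(1 / 2) : ℝ) (1 / 2)) :
    c₀ / 2 * h ^ k ≤
      |(derivative^[k] (derivative (primPoly (scaledJet u h x) r))).eval ξ| := by
  obtain ⟨N, rfl⟩ : ∃ N, r = (N + 1) + k := ⟨r - k - 1, by omega⟩
  have hM0 : 0 ≤ M := (abs_nonneg _).trans (hJ.bound 0 (by omega) x hx)
  have hξ1 : |ξ| ≤ 1 := by rw [abs_le]; constructor <;> linarith [hξ.1, hξ.2]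
  rw [iterate_derivative_primPoly, eval_derivative_primPoly, sum_range_succ']
  simp only [pow_zero, mul_one, Nat.factorial_zero, Nat.cast_one, div_one, zero_add]
  -- Every term beyond the first carries an extra factor `h`, so the term of order `k` dominates for
  -- small `h`.
  have hrest : |∑ l ∈ range N, scaledJet u h x (l + 1 + k) * ξ ^ (l + 1) / (l + 1).factorial|
      ≤ N * (M * h * h ^ k) := by
    refine (abs_sum_le_sum_abs _ _).trans ?_
    calc _ ≤ ∑ l ∈ range N, M * h * h ^ k := sum_le_sum fun l hl => ?_
      _ = _ := by simp
    rw [mem_range] at hl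
    rw [abs_div, abs_mul, scaledJet, abs_mul, abs_pow, abs_pow, abs_of_pos hh, Nat.abs_cast]
    have h1 : |iteratedDeriv (l + 1 + k) u x| ≤ M := hJ.bound _ (by omega) x hx
    have h2 : h ^ (l + 1 + k) ≤ h * h ^ k := by
      rw [← pow_succ']; exact pow_le_pow_of_le_one hh.le hh1 (by omega)
    have h3 : |ξ| ^ (l + 1) ≤ 1 := pow_le_one₀ (abs_nonneg _) hξ1
    have h4 : (1 : ℝ) ≤ (l + 1).factorial := by exact_mod_cast (l + 1).factorial_pos
    calc |iteratedDeriv (l + 1 + k) u x| * h ^ (l + 1 + k) * |ξ| ^ (l + 1) / (l + 1).factorial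
        ≤ |iteratedDeriv (l + 1 + k) u x| * h ^ (l + 1 + k) * |ξ| ^ (l + 1) :=
          div_le_self (by positivity) h4
      _ ≤ M * (h * h ^ k) * 1 := by gcongr
      _ = _ := by ring
  have hmain : c₀ * h ^ k ≤ |scaledJet u h x k| := by
    rw [scaledJet, abs_mul, abs_pow, abs_of_pos hh]; gcongr
  have hN : (N : ℝ) * (M * h * h ^ k) ≤ c₀ / 2 * h ^ k := by
    have : (N : ℝ) * M * h ≤ ((N + 1 + k : ℕ) : ℝ) * M * h := by
      gcongr; omega
    calc (N : ℝ) * (M * h * h ^ k) = (N * M * h) * h ^ k := by ring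
      _ ≤ _ := by gcongr; exact this.trans hsmall
  have := abs_sub_abs_le_abs_add (scaledJet u h x k)
    (∑ l ∈ range N, scaledJet u h x (l + 1 + k) * ξ ^ (l + 1) / (l + 1).factorial)
  rw [add_comm (∑ l ∈ range N, _)]
  linarith

/-- The indicators agree up to a relative error `O(h ^ (r - k))` if the derivative of
order `k < r` does not vanish. -/
lemma JetOn.smoothInd_close {u : ℝ → ℝ} {x₀ R M c₀ : ℝ} {r k : ℕ} (hJ : JetOn u x₀ R M r)
    (hM : 0 ≤ M) (hk1 : 1 ≤ k) (hk : k < r) (hc₀ : 0 < c₀)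
    (hc : ∀ x, |x - x₀| < R → c₀ ≤ |iteratedDeriv k u x|) :
    ∃ K ≥ 0, ∃ h₀ > 0, ∀ h, 0 < h → h < h₀ → ∀ x, |x - x₀| + (r + 1) * h < R →
      ∃ B > 0, ∀ s, |smoothInd r (fun m : ℤ => cellAvg u h (x + m * h)) s - B|
        ≤ K * h ^ (r - k) * B := by
  obtain ⟨K₁, hK₁, hstab⟩ := exists_subPoly_bound r
  set κ : ℝ := K₁ * (M * (r + 1) ^ r) with hκ
  refine ⟨1 + r * (2 * κ ^ 2) / (c₀ / 2) ^ 2, by positivity,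
    min 1 (c₀ / 2 / (r * M + 1)), by positivity, ?_⟩
  intro h hh hh0 x hx
  have hh1 : h ≤ 1 := (hh0.trans_le (min_le_left _ _)).le
  have hsmall : r * M * h ≤ c₀ / 2 := by
    have := (hh0.trans_le (min_le_right _ _)).le
    rw [le_div_iff₀ (by positivity)] at this
    linarith
  have hx' : |x - x₀| < R := by
    have : 0 < ((r : ℝ) + 1) * h := by positivity
    linarith
  set Q := primPoly (scaledJet u h x) r with hQ
  set w : ℤ → ℝ := fun m => Q.eval ((m : ℝ) + 1 / 2) - Q.eval ((m : ℝ) - 1 / 2) with hw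
  set e : ℤ → ℝ := fun m => cellAvg u h (x + m * h) - w m with he
  have hve : (fun m : ℤ => cellAvg u h (x + m * h)) = fun m => w m + e m := by
    funext m; simp [he]
  -- The common value `B` is the indicator of the Taylor polynomial, and it is not smaller than `h ^
  -- (2 k)` in order.
  have hB : (c₀ / 2 * h ^ k) ^ 2 ≤ polyInd r (derivative Q) :=
    le_polyInd hk1 hk _ (by positivity)
      (hJ.le_iterate_derivative hk hh hh1 hx' (hc x hx') hsmall)
  refine ⟨polyInd r (derivative Q), lt_of_lt_of_le (by positivity) hB, fun s => ?_⟩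
  have hβ : smoothInd r (fun m : ℤ => cellAvg u h (x + m * h)) s =
      polyInd r (derivative Q + subPoly r s e) := by
    rw [hve, smoothInd, subPoly_add, subPoly_primitive r s Q (natDegree_primPoly_le _ _), polyInd]
  have hη : 0 < h ^ (r - k) := by positivity
  -- The choice `η = h ^ (r - k)` balances both terms: `η⁻¹ * h ^ (2 r) = h ^ (r - k) * h ^ (2 k)`,
  -- which is `O(η B)`.
  have hle := polyInd_add_sub_le r (derivative Q) (subPoly r s e) (η := h ^ (r - k))
    (κ := κ * h ^ r) hη (fun l hl ξ hξ => by
      have := hstab e (M * (r + 1) ^ r * h ^ r) (by positivity)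
        (fun m hm => hJ.cellAvg_sub_le (by omega) hh hx hm) s l hl ξ hξ
      rwa [hκ, mul_assoc])
  rw [hβ]
  refine hle.trans ?_
  have h1 : ((h ^ (r - k))⁻¹ + 1) * (κ * h ^ r) ^ 2 ≤ 2 * κ ^ 2 * (h ^ (r - k) * (h ^ k) ^ 2) := by
    have e0 : h ^ r = h ^ (r - k) * h ^ k := by rw [← pow_add, Nat.sub_add_cancel hk.le]
    have e1 : h ^ (r - k) ≤ 1 := pow_le_one₀ hh.le hh1
    have e2 : ((h ^ (r - k))⁻¹ + 1) * (κ * h ^ r) ^ 2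
        = (1 + h ^ (r - k)) * (κ ^ 2 * (h ^ (r - k) * (h ^ k) ^ 2)) := by
      rw [e0]; field_simp
    rw [e2, mul_assoc]
    gcongr
    linarith
  have h2 : r * (2 * κ ^ 2) * (h ^ (r - k) * (h ^ k) ^ 2) ≤
      r * (2 * κ ^ 2) / (c₀ / 2) ^ 2 * h ^ (r - k) * polyInd r (derivative Q) := by
    calc r * (2 * κ ^ 2) * (h ^ (r - k) * (h ^ k) ^ 2)
        = r * (2 * κ ^ 2) / (c₀ / 2) ^ 2 * h ^ (r - k) * (c₀ / 2 * h ^ k) ^ 2 := by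
          field_simp
      _ ≤ _ := by gcongr
  have h3 : r * (((h ^ (r - k))⁻¹ + 1) * (κ * h ^ r) ^ 2) ≤
      r * (2 * κ ^ 2) * (h ^ (r - k) * (h ^ k) ^ 2) := by
    rw [mul_assoc (r : ℝ)]; gcongr
  rw [add_mul, add_mul, one_mul]
  linarith

end WENO
namespace WENO

open Finset

/-! ### The nonlinear weights -/

/-- As the `d s` sum to `1`, the sum of the `a s` is within `r * τ` of `1`, and dividing by it costs
only a constant factor. -/
lemma normalize_close {r : ℕ} (d a : Fin r → ℝ) (hd0 : ∀ s, 0 ≤ d s) (hd : ∑ s, d s = 1) {τ : ℝ}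
    (ha : ∀ s, |a s - d s| ≤ τ) (hτ : r * τ ≤ 1 / 2) :
    1 / 2 ≤ ∑ s, a s ∧ ∀ s, |a s / ∑ l, a l - d s| ≤ 2 * (r + 1) * τ := by
  have hsum : |∑ s, a s - 1| ≤ r * τ := by
    rw [← hd, ← sum_sub_distrib]
    refine (abs_sum_le_sum_abs _ _).trans ((sum_le_sum fun s _ => ha s).trans ?_)
    simp
  have hhalf : 1 / 2 ≤ ∑ s, a s := by linarith [(abs_le.1 hsum).1]
  refine ⟨hhalf, fun s => ?_⟩
  have hpos : 0 < ∑ s, a s := by linarith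
  have hd1 : d s ≤ 1 := by
    rw [← hd]; exact single_le_sum (fun j _ => hd0 j) (mem_univ s)
  have heq : a s / ∑ l, a l - d s = ((a s - d s) - d s * (∑ l, a l - 1)) / ∑ l, a l := by
    field_simp; ring
  rw [heq, abs_div, abs_of_pos hpos, div_le_iff₀ hpos]
  have h1 : |(a s - d s) - d s * (∑ l, a l - 1)| ≤ τ + r * τ := by
    refine (abs_sub _ _).trans ?_
    rw [abs_mul, abs_of_nonneg (hd0 s)]
    have : d s * |∑ l, a l - 1| ≤ 1 * (r * τ) := mul_le_mul hd1 hsum (abs_nonneg _) zero_le_one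
    linarith [ha s]
  have hτ0 : 0 ≤ τ := (abs_nonneg _).trans (ha s)
  have h2 : (0 : ℝ) ≤ 2 * (r + 1) * τ := by positivity
  nlinarith

lemma abs_inv_sq_one_add_sub_one_le {θ τ : ℝ} (hθ : |θ| ≤ τ) (hτ : τ ≤ 1 / 2) :
    |((1 + θ) ^ 2)⁻¹ - 1| ≤ 10 * τ := by
  have h := abs_le.1 hθ
  have hp : 1 / 4 ≤ (1 + θ) ^ 2 := by nlinarith [h.1]
  have heq : ((1 + θ) ^ 2)⁻¹ - 1 = -(θ * (2 + θ)) / (1 + θ) ^ 2 := by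
    have : (1 + θ) ^ 2 ≠ 0 := by positivity
    rw [eq_div_iff this, sub_mul, inv_mul_cancel₀ this]
    ring
  rw [heq, abs_div, abs_neg, abs_mul, abs_of_pos (by positivity : 0 < (1 + θ) ^ 2),
    div_le_iff₀ (by positivity)]
  have h2 : |2 + θ| ≤ 5 / 2 := by rw [abs_le]; constructor <;> linarith [h.1, h.2]
  have h3 : |θ| * |2 + θ| ≤ τ * (5 / 2) :=
    mul_le_mul hθ h2 (abs_nonneg _) ((abs_nonneg _).trans hθ)
  have hτ0 : 0 ≤ τ := (abs_nonneg _).trans hθ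
  nlinarith

/-- The deviation of the Jiang–Shu weights from the optimal ones, uniformly in `ε`. -/
lemma weightJS_close {r : ℕ} (hr : 0 < r) {v : ℤ → ℝ} {B τ ε : ℝ} (hB : 0 < B) (hε : 0 ≤ ε)
    (hβ : ∀ s, |smoothInd r v s - B| ≤ τ * B) (hτ : r * (10 * τ) ≤ 1 / 2) (s : Fin r) :
    |weightJS r ε v s - optWeight r s| ≤ 20 * (r + 1) * τ := by
  have hτ0 : 0 ≤ τ := by
    have := (abs_nonneg _).trans (hβ s)
    exact nonneg_of_mul_nonneg_left this hB
  have hr1 : (1 : ℝ) ≤ r := by exact_mod_cast hr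
  have hτ1 : τ ≤ 1 / 2 := by nlinarith
  have hD : 0 < ε + B := by linarith
  -- The common factor `(ε + B) ^ 2` cancels on normalization. The relative deviation `θ` has
  -- denominator `ε + B ≥ B`, so its bound `τ` holds for every `ε ≥ 0`.
  have ha : ∀ s, |(ε + B) ^ 2 * alphaJS r ε v s - optWeight r s| ≤ 10 * τ := by
    intro s
    set θ := (smoothInd r v s - B) / (ε + B) with hθdef
    have hθ : |θ| ≤ τ := by
      rw [hθdef, abs_div, abs_of_pos hD, div_le_iff₀ hD]
      refine (hβ s).trans ?_
      gcongr; linarith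
    have h1 : ε + smoothInd r v s = (ε + B) * (1 + θ) := by
      rw [hθdef]; field_simp; ring
    have hpos : 0 < 1 + θ := by linarith [(abs_le.1 hθ).1]
    have h2 : (ε + B) ^ 2 * alphaJS r ε v s - optWeight r s =
        optWeight r s * (((1 + θ) ^ 2)⁻¹ - 1) := by
      rw [alphaJS, h1]; field_simp
    rw [h2, abs_mul, abs_of_pos (optWeight_pos s)]
    have hd1 : optWeight r s ≤ 1 := by
      rw [← sum_optWeight hr]
      exact single_le_sum (fun j _ => (optWeight_pos j).le) (mem_univ s)
    calc _ ≤ 1 * (10 * τ) := mul_le_mul hd1 (abs_inv_sq_one_add_sub_one_le hθ hτ1)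
          (abs_nonneg _) zero_le_one
      _ = _ := one_mul _
  have := (normalize_close (optWeight r) (fun s => (ε + B) ^ 2 * alphaJS r ε v s)
    (fun s => (optWeight_pos s).le) (sum_optWeight hr) ha hτ).2 s
  rw [← mul_sum, mul_div_mul_left _ _ (by positivity)] at this
  rw [weightJS]
  linarith

/-! ### The mapping functions near the optimal weights -/

/-- The order of contact with `d` of the mapping function at `d`. -/
def mapOrder (k : ℕ) : ℕ := if Even k then k + 1 else k + 2

/-- The parity term in `kMAIM` raises an even `c` to the odd number `c + 1`, so the threshold is
odd. An even `k` above it exceeds it by at least one, which makes up for its lower contact order; in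
all cases `mapOrder k ≥ c + 2 ≥ r / (r - 1 - n)`. -/
lemma le_mapOrder_mul {r n k : ℕ} (hn : n + 1 < r) (hk : kMAIM r n ≤ (k : ℝ)) :
    r ≤ mapOrder k * (r - (n + 1)) := by
  set c : ℤ := ⌈(r : ℝ) / ((r : ℝ) - 1 - n) - 2⌉ with hc
  have hpos : (0 : ℝ) < (r : ℝ) - 1 - n := by
    have : ((n + 1 : ℕ) : ℝ) < r := by exact_mod_cast hn
    push_cast at this; linarith
  have hck : c + 2 ≤ (mapOrder k : ℤ) := by
    rw [kMAIM, ← hc] at hk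
    rcases Int.even_or_odd c with he | ho
    · rw [he.neg_one_zpow] at hk
      have hk' : c + 1 ≤ k := by
        have : (c : ℝ) + 1 ≤ k := by linarith
        exact_mod_cast this
      rw [mapOrder]
      split_ifs with hev
      · obtain ⟨a, ha⟩ := he
        obtain ⟨b, hb⟩ := hev
        push_cast; omega
      · push_cast; omega
    · rw [ho.neg_one_zpow] at hk
      have hk' : c ≤ k := by
        have : (c : ℝ) ≤ k := by linarith
        exact_mod_cast this
      rw [mapOrder]
      split_ifs with hev
      · obtain ⟨a, ha⟩ := ho
        obtain ⟨b, hb⟩ := hev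
        push_cast; omega
      · push_cast; omega
  have h1 : (r : ℝ) / ((r : ℝ) - 1 - n) ≤ mapOrder k := by
    have h2 := Int.le_ceil ((r : ℝ) / ((r : ℝ) - 1 - n) - 2)
    rw [← hc] at h2
    have h3 : (c : ℝ) + 2 ≤ mapOrder k := by exact_mod_cast hck
    linarith
  rw [div_le_iff₀ hpos] at h1
  have h4 : ((r - (n + 1) : ℕ) : ℝ) = (r : ℝ) - 1 - n := by
    rw [Nat.cast_sub hn.le]; push_cast; ring
  rw [← h4] at h1
  exact_mod_cast h1

lemma sg_mul_nonneg {k : ℕ} {δ x : ℝ} : 0 ≤ sg k δ x * x := by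
  rw [sg]
  split_ifs with h
  · rw [div_mul_eq_mul_div]
    exact div_nonneg (mul_self_nonneg x) (abs_nonneg x)
  · rw [div_mul_eq_mul_div]
    have hx : |x| < δ := not_le.1 h
    have : x ^ 2 < δ ^ 2 := by
      rw [← sq_abs x]; exact pow_lt_pow_left₀ hx (abs_nonneg x) two_ne_zero
    exact div_nonneg (mul_self_nonneg x)
      (add_nonneg (pow_nonneg (by linarith) _) (abs_nonneg x))

/-- Near zero the denominator of `sg` stays away from zero, so `sg` is `O(x)`: this is the extra
order of contact for odd `k`. -/
lemma abs_sg_le {k : ℕ} {δ x : ℝ} (hδ : 0 < δ) (hx : |x| ≤ δ / 2) :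
    |sg k δ x| ≤ ((δ ^ 2 / 2) ^ (k + 3))⁻¹ * |x| := by
  have hx2 : x ^ 2 ≤ (δ / 2) ^ 2 := by
    rw [← sq_abs x]; exact pow_le_pow_left₀ (abs_nonneg x) hx 2
  have hp : (δ ^ 2 / 2) ^ (k + 3) ≤ (δ ^ 2 - x ^ 2) ^ (k + 3) + |x| := by
    have : (δ ^ 2 / 2) ^ (k + 3) ≤ (δ ^ 2 - x ^ 2) ^ (k + 3) := by
      gcongr; nlinarith
    linarith [abs_nonneg x]
  have hp0 : 0 < (δ ^ 2 / 2) ^ (k + 3) := by positivity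
  rw [sg, if_neg (by linarith), abs_div, abs_of_pos (hp0.trans_le hp), inv_mul_eq_div]
  gcongr

/-- For odd `k` the sign of `(z - d) ^ k` is matched by that of `sg`. Hence the denominator of the
mapping function is at least `ω ^ e0 * (1 - ω) ^ e1`. -/
lemma fMAIM_mul_pow_nonneg {k : ℕ} {A δ d z : ℝ} (hA : 0 ≤ A) :
    0 ≤ fMAIM k A δ d z * (z - d) ^ k := by
  rw [fMAIM]
  rcases Nat.even_or_odd k with he | ho
  · rw [he.neg_one_pow, he.add_one.neg_one_pow]
    have := he.pow_nonneg (z - d)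
    norm_num
    positivity
  · rw [ho.neg_one_pow, ho.add_one.neg_one_pow]
    obtain ⟨j, rfl⟩ := ho
    have h1 : 0 ≤ sg (2 * j + 1) δ (z - d) * (z - d) := sg_mul_nonneg
    have h2 : 0 ≤ A * ((z - d) ^ j) ^ 2 := by positivity
    have h3 := mul_nonneg h2 h1
    norm_num
    calc (0 : ℝ) ≤ _ := h3
      _ = _ := by ring

lemma exists_abs_fMAIM_mul_le (k : ℕ) {A δ : ℝ} (hA : 0 ≤ A) (hδ : 0 < δ) (d : ℝ) :
    ∃ K ≥ 0, ∀ z, |z - d| ≤ δ / 2 →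
      |fMAIM k A δ d z * (z - d) ^ (k + 1)| ≤ K * |z - d| ^ mapOrder k := by
  rcases Nat.even_or_odd k with he | ho
  · refine ⟨A, hA, fun z _ => le_of_eq ?_⟩
    rw [mapOrder, if_pos he, fMAIM, he.neg_one_pow, he.add_one.neg_one_pow, abs_mul, abs_pow]
    norm_num [abs_of_nonneg hA]
  · refine ⟨A * ((δ ^ 2 / 2) ^ (k + 3))⁻¹, by positivity, fun z hz => ?_⟩
    rw [mapOrder, if_neg (Nat.not_even_iff_odd.2 ho), fMAIM, ho.neg_one_pow,
      ho.add_one.neg_one_pow, abs_mul, abs_pow, abs_mul, abs_of_nonneg hA]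
    have h := abs_sg_le (k := k) hδ hz
    norm_num
    calc A * |sg k δ (z - d)| * |z - d| ^ (k + 1)
        ≤ A * (((δ ^ 2 / 2) ^ (k + 3))⁻¹ * |z - d|) * |z - d| ^ (k + 1) := by gcongr
      _ = A * ((δ ^ 2 / 2) ^ (k + 3))⁻¹ * |z - d| ^ (k + 2) := by ring
      _ = _ := by norm_num

lemma exists_gMAIM_close (k : ℕ) {A δ d E : ℝ} (hA : 0 ≤ A) (hδ : 0 < δ) (hd0 : 0 < d)
    (hd1 : d < 1) (hE : 0 ≤ E) :
    ∃ K ≥ 0, ∀ z e0 e1, |z - d| ≤ δ / 2 → |z - d| ≤ d / 2 → |z - d| ≤ (1 - d) / 2 →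
      e0 ≤ E → e1 ≤ E → |gMAIM k A δ d e0 e1 z - d| ≤ K * |z - d| ^ mapOrder k := by
  obtain ⟨K, hK, hbound⟩ := exists_abs_fMAIM_mul_le k hA hδ d
  have hd1' : 0 < 1 - d := by linarith
  set c := (d / 2) ^ E * ((1 - d) / 2) ^ E with hc
  have hc0 : 0 < c := by positivity
  refine ⟨K / c, by positivity, fun z e0 e1 h1 h2 h3 he0 he1 => ?_⟩
  have hz0 : d / 2 ≤ z := by linarith [(abs_le.1 h2).1]
  have hz1 : (1 - d) / 2 ≤ 1 - z := by linarith [(abs_le.1 h3).2]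
  -- Since `z` and `1 - z` lie in `(0, 1)`, an upper bound on the exponents suffices to keep the
  -- powers away from zero.
  have p0 : (d / 2) ^ E ≤ z ^ e0 :=
    (Real.rpow_le_rpow (by positivity) hz0 hE).trans
      (Real.rpow_le_rpow_of_exponent_ge (by linarith) (by linarith) he0)
  have p1 : ((1 - d) / 2) ^ E ≤ (1 - z) ^ e1 :=
    (Real.rpow_le_rpow (by positivity) hz1 hE).trans
      (Real.rpow_le_rpow_of_exponent_ge (by linarith) (by linarith) he1)
  have hden : c ≤ fMAIM k A δ d z * (z - d) ^ k + z ^ e0 * (1 - z) ^ e1 := by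
    have q0 : (0 : ℝ) ≤ (d / 2) ^ E := by positivity
    have q1 : (0 : ℝ) ≤ ((1 - d) / 2) ^ E := by positivity
    have := mul_le_mul p0 p1 q1 (q0.trans p0)
    linarith [fMAIM_mul_pow_nonneg (k := k) (δ := δ) (d := d) (z := z) hA]
  rw [gMAIM, add_sub_cancel_left, abs_div, abs_of_pos (hc0.trans_le hden), div_mul_eq_mul_div]
  have := hbound z h1
  gcongr

/-- Near the optimal weights the adaptive control functions are bounded. -/
lemma exists_adaptive_exponent_bound {r k : ℕ} (hr : 2 ≤ r) (T : AdaType r)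
    (hT : T.Admissible k) {εA : ℝ} (hεA : 0 ≤ εA) :
    ∃ E ≥ 0, ∀ (β w : Fin r → ℝ) (B : ℝ), 0 < B → (∀ j, |β j - B| ≤ B / 2) →
      (∀ j, |w j - optWeight r j| ≤ optWeight r j / 2) →
      (∀ j, |w j - optWeight r j| ≤ (1 - optWeight r j) / 2) →
      ∀ s, T.exp0 k εA β w s ≤ E ∧ T.exp1 k εA β w s ≤ E := by
  have hne : Nonempty (Fin r) := ⟨⟨0, by omega⟩⟩
  -- The bound `3` is `(3 b / 2) / (b / 2)`; `εA ≥ 0` only lowers the quotient. It serves type 3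
  -- with `b = B` and type 4 with `b = 1`.
  have hratio : ∀ (a : Fin r → ℝ) (b : ℝ), 0 < b → (∀ j, |a j - b| ≤ b / 2) →
      (⨆ j, a j) / ((⨅ j, a j) + εA) ≤ 3 := by
    intro a b hb ha
    have h1 : (⨆ j, a j) ≤ 3 * b / 2 := ciSup_le fun j => by linarith [(abs_le.1 (ha j)).2]
    have h2 : b / 2 ≤ ⨅ j, a j := le_ciInf fun j => by linarith [(abs_le.1 (ha j)).1]
    rw [div_le_iff₀ (by linarith)]
    linarith
  cases T with
  | type1 m =>
    have hm : ∀ s, 0 < m s := hT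
    refine ⟨∑ s, 2 / m s, sum_nonneg fun s _ => (div_pos two_pos (hm s)).le, ?_⟩
    intro β w B _ _ hw0 hw1 s
    have hle : 2 / m s ≤ ∑ s, 2 / m s :=
      single_le_sum (f := fun s => 2 / m s) (fun s _ => (div_pos two_pos (hm s)).le) (mem_univ s)
    have hb : ∀ d z : ℝ, 0 < d → d / 2 ≤ z → d / (m s * z + εA) ≤ 2 / m s := by
      intro d z hd hz
      have hmz : m s * (d / 2) ≤ m s * z := mul_le_mul_of_nonneg_left hz (hm s).le
      have hpos : 0 < m s * (d / 2) := mul_pos (hm s) (by linarith)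
      rw [div_le_div_iff₀ (by linarith) (hm s)]
      linarith
    exact ⟨(hb _ _ (optWeight_pos s) (by linarith [(abs_le.1 (hw0 s)).1])).trans hle,
      (hb _ _ (by linarith [optWeight_lt_one hr s])
        (by linarith [(abs_le.1 (hw1 s)).2])).trans hle⟩
  | type2 Q CFS =>
    refine ⟨max 1 (Q * k), le_max_of_le_left zero_le_one, ?_⟩
    intro β w B _ _ _ _ s
    have : ada2 k Q CFS s (w s) ≤ max 1 (Q * k) := by
      rw [ada2]; split_ifs
      · exact le_max_left _ _
      · exact le_max_right _ _
    exact ⟨this, this⟩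
  | type3 =>
    refine ⟨3, by norm_num, fun β w B hB hβ _ _ s => ?_⟩
    exact ⟨hratio β B hB hβ, hratio β B hB hβ⟩
  | type4 =>
    refine ⟨3, by norm_num, fun β w B _ _ hw _ s => ?_⟩
    have := hratio (fun j => w j / optWeight r j) 1 one_pos (fun j => by
      have hd := optWeight_pos j
      rw [div_sub_one hd.ne', abs_div, abs_of_pos hd, div_le_iff₀ hd]
      linarith [hw j])
    exact ⟨this, this⟩
  | type5 C =>
    have hC : 1 ≤ C := hT
    exact ⟨C, by linarith, fun β w B _ _ _ _ s => ⟨le_rfl, le_rfl⟩⟩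

end WENO
namespace WENO

open Polynomial Finset

/-! ### The expansion of the reconstruction error -/

lemma JetOn.mono_radius {u : ℝ → ℝ} {x₀ R R' M : ℝ} {N : ℕ} (hJ : JetOn u x₀ R M N)
    (h : R' ≤ R) : JetOn u x₀ R' M N :=
  ⟨fun l hl y hy => hJ.hasDerivAt l hl y (hy.trans_le h),
    fun l hl y hy => hJ.bound l hl y (hy.trans_le h)⟩

lemma exists_pos_le_all {ι : Type*} [Finite ι] (c : ι → ℝ) (hc : ∀ i, 0 < c i) :
    ∃ θ > 0, ∀ i, θ ≤ c i := by
  have h1 : ∀ᶠ θ in nhdsWithin (0 : ℝ) (Set.Ioi 0), ∀ i, θ ≤ c i :=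
    Filter.eventually_all.2 fun i =>
      eventually_nhdsWithin_of_eventually_nhds (eventually_le_nhds (hc i))
  obtain ⟨θ, h, hθ⟩ := (h1.and self_mem_nhdsWithin).exists
  exact ⟨θ, hθ, h⟩

/-- Both families of weights sum to `1`, so `y` can be subtracted inside: the nonlinear part becomes
a sum of products of two small factors. -/
lemma recon_eq_of_sum_weight {r : ℕ} (P : Params r) (v : ℤ → ℝ) (hr : 0 < r)
    (hw : ∑ s, weightMAIM P v s = 1) (y : ℝ) :
    recon P v - y = ∑ s, (weightMAIM P v s - optWeight r s) * (subValue r s v - y) +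
      (∑ s, optWeight r s * subValue r s v - y) := by
  simp only [sub_mul, mul_sub, sum_sub_distrib, ← sum_mul, hw, sum_optWeight hr, recon]
  ring

/-- The nonlinear weights deviate from the optimal ones by `O(h ^ r)`, uniformly in `ε`. -/
lemma JetOn.weightMAIM_close {u : ℝ → ℝ} {x₀ R M c₀ : ℝ} {r n k : ℕ} (hJ : JetOn u x₀ R M r)
    (hM : 0 ≤ M) (hn : n + 1 < r) (hk : kMAIM r n ≤ (k : ℝ)) (hc₀ : 0 < c₀)
    (hc : ∀ x, |x - x₀| < R → c₀ ≤ |iteratedDeriv (n + 1) u x|)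
    {A δ εA : ℝ} (hA : 0 < A) (hδ : 0 < δ) (hεA : 0 ≤ εA) (T : AdaType r)
    (hT : T.Admissible k) :
    ∃ K ≥ 0, ∃ h₀ > 0, ∀ ε ≥ 0, ∀ h, 0 < h → h < h₀ → ∀ x, |x - x₀| + (r + 1) * h < R →
      ∑ s, weightMAIM (r := r) ⟨k, A, δ, ε, εA, T⟩
        (fun m : ℤ => cellAvg u h (x + m * h)) s = 1 ∧
      ∀ s, |weightMAIM (r := r) ⟨k, A, δ, ε, εA, T⟩ (fun m : ℤ => cellAvg u h (x + m * h)) s -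
        optWeight r s| ≤ K * h ^ r := by
  have hr : 2 ≤ r := by omega
  obtain ⟨K₁, hK₁, h₁, hh₁, hβ⟩ := hJ.smoothInd_close hM (by omega) hn hc₀ hc
  obtain ⟨E, hE, hexp⟩ := exists_adaptive_exponent_bound hr T hT hεA
  choose Kg hKg hg using fun s : Fin r => exists_gMAIM_close k hA.le hδ (optWeight_pos s)
    (optWeight_lt_one hr s) hE
  obtain ⟨θ₁, hθ₁, hθd⟩ := exists_pos_le_all (fun s : Fin r => optWeight r s / 2)
    fun s => by linarith [optWeight_pos s]
  obtain ⟨θ₂, hθ₂, hθd'⟩ := exists_pos_le_all (fun s : Fin r => (1 - optWeight r s) / 2)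
    fun s => by linarith [optWeight_lt_one hr s]
  -- Weights within `θ` of the optimal ones meet the proximity conditions of the mapping and
  -- exponent bounds; the entry `1 / 2` also keeps the indicators within `B / 2` of `B`.
  set θ := min (min (1 / 2) (δ / 2)) (min θ₁ θ₂) with hθ
  have hθ0 : 0 < θ := by positivity
  set L : ℝ := 20 * (r + 1) * K₁ with hL
  have hL0 : 0 ≤ L := by positivity
  set K₂ : ℝ := (∑ s, Kg s) * L ^ mapOrder k with hK₂
  have hK₂0 : 0 ≤ K₂ := mul_nonneg (sum_nonneg fun s _ => hKg s) (pow_nonneg hL0 _)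
  -- The entry with `θ` yields `L * h ^ p ≤ θ`; the last one yields `r * K₂ * h ^ r ≤ 1 / 2`, needed
  -- for the normalization.
  refine ⟨2 * (r + 1) * K₂, by positivity,
    min (min 1 h₁) (min (θ / (L + 1)) (1 / (2 * (r * K₂ + 1)))), by positivity, ?_⟩
  intro ε hε h hh hlt x hx
  have hh1 : h ≤ 1 := (hlt.trans_le ((min_le_left _ _).trans (min_le_left _ _))).le
  have hlt1 : h < h₁ := hlt.trans_le ((min_le_left _ _).trans (min_le_right _ _))
  have hlt2 : h < θ / (L + 1) := hlt.trans_le ((min_le_right _ _).trans (min_le_left _ _))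
  have hlt3 : h < 1 / (2 * (r * K₂ + 1)) :=
    hlt.trans_le ((min_le_right _ _).trans (min_le_right _ _))
  rw [lt_div_iff₀ (by positivity)] at hlt2 hlt3
  obtain ⟨B, hB, hBs⟩ := hβ h hh hlt1 x hx
  set v : ℤ → ℝ := fun m : ℤ => cellAvg u h (x + m * h)
  set p := r - (n + 1) with hp
  have hpp : h ^ p ≤ h := by
    simpa using pow_le_pow_of_le_one hh.le hh1 (show 1 ≤ p by omega)
  have hLτ : L * h ^ p ≤ θ := by
    have : L * h ^ p ≤ L * h := by gcongr
    nlinarith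
  have hτeq : 20 * ((r : ℝ) + 1) * (K₁ * h ^ p) = L * h ^ p := by rw [hL]; ring
  have hτ0 : 0 ≤ K₁ * h ^ p := by positivity
  have hθle : θ ≤ 1 / 2 := (min_le_left _ _).trans (min_le_left _ _)
  have hθδ : θ ≤ δ / 2 := (min_le_left _ _).trans (min_le_right _ _)
  have hθle1 : θ ≤ θ₁ := (min_le_right _ _).trans (min_le_left _ _)
  have hθle2 : θ ≤ θ₂ := (min_le_right _ _).trans (min_le_right _ _)
  have hr0 : (0 : ℝ) ≤ r := r.cast_nonneg
  have hw : ∀ s, |weightJS r ε v s - optWeight r s| ≤ L * h ^ p := fun s => by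
    rw [← hτeq]
    exact weightJS_close (by omega) hB hε hBs (by nlinarith) s
  have hα : ∀ s, |alphaMAIM (r := r) ⟨k, A, δ, ε, εA, T⟩ v s - optWeight r s| ≤ K₂ * h ^ r := by
    intro s
    have he := hexp (smoothInd r v) (weightJS r ε v) B hB
      (fun j => (hBs j).trans (by nlinarith))
      (fun j => ((hw j).trans hLτ).trans (hθle1.trans (hθd j)))
      (fun j => ((hw j).trans hLτ).trans (hθle2.trans (hθd' j))) s
    have hgs := hg s (weightJS r ε v s) _ _ (((hw s).trans hLτ).trans hθδ)
      (((hw s).trans hLτ).trans (hθle1.trans (hθd s)))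
      (((hw s).trans hLτ).trans (hθle2.trans (hθd' s))) he.1 he.2
    refine hgs.trans ?_
    -- The threshold on `k` enters here: `(h ^ p) ^ mapOrder k ≤ h ^ r`.
    have h1 : |weightJS r ε v s - optWeight r s| ^ mapOrder k ≤ L ^ mapOrder k * h ^ r := by
      calc _ ≤ (L * h ^ p) ^ mapOrder k := pow_le_pow_left₀ (abs_nonneg _) (hw s) _
        _ = L ^ mapOrder k * h ^ (mapOrder k * p) := by
          rw [mul_pow, ← pow_mul, mul_comm p]
        _ ≤ _ := by
          have := pow_le_pow_of_le_one hh.le hh1 (le_mapOrder_mul hn hk)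
          gcongr
    have h2 : Kg s ≤ ∑ s, Kg s := single_le_sum (fun s _ => hKg s) (mem_univ s)
    calc _ ≤ (∑ s, Kg s) * (L ^ mapOrder k * h ^ r) :=
          mul_le_mul h2 h1 (by positivity) ((hKg s).le.trans h2)
      _ = _ := by rw [hK₂]; ring
  have hhr : h ^ r ≤ h := by
    simpa using pow_le_pow_of_le_one hh.le hh1 (show 1 ≤ r by omega)
  have hsmall : r * (K₂ * h ^ r) ≤ 1 / 2 := by
    have : r * (K₂ * h ^ r) ≤ r * (K₂ * h) := by gcongr
    nlinarith
  obtain ⟨hsum, hclose⟩ := normalize_close (optWeight r)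
    (alphaMAIM (r := r) ⟨k, A, δ, ε, εA, T⟩ v) (fun s => (optWeight_pos s).le)
    (sum_optWeight (by omega)) hα hsmall
  refine ⟨?_, fun s => ?_⟩
  · simp only [weightMAIM]
    rw [← sum_div, div_self (by linarith)]
  · rw [mul_assoc]
    exact hclose s

/-- The substencil values are accurate of order `r`. -/
lemma JetOn.exists_subValue_close {u : ℝ → ℝ} {x₀ R M : ℝ} {r : ℕ} (hJ : JetOn u x₀ R M r)
    (hM : 0 ≤ M) :
    ∃ K ≥ 0, ∀ h, 0 < h → ∀ x, |x - x₀| + (r + 1) * h < R → ∀ s : Fin r,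
      |subValue r s (fun m : ℤ => cellAvg u h (x + m * h)) - u (x + h / 2)| ≤ K * h ^ r := by
  obtain ⟨K₁, hK₁, hstab⟩ := exists_subPoly_bound r
  refine ⟨K₁ * (M * (r + 1) ^ r) + M * (r + 1) ^ r, by positivity, fun h hh x hx s => ?_⟩
  have hr : 0 < r := Nat.pos_of_ne_zero fun h0 => by have := s.2; omega
  set Q := primPoly (scaledJet u h x) r with hQ
  set w : ℤ → ℝ := fun m => Q.eval ((m : ℝ) + 1 / 2) - Q.eval ((m : ℝ) - 1 / 2) with hw
  set e : ℤ → ℝ := fun m => cellAvg u h (x + m * h) - w m with he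
  have hve : (fun m : ℤ => cellAvg u h (x + m * h)) = fun m => w m + e m := by
    funext m; simp [he]
  have h1 := hstab e (M * (r + 1) ^ r * h ^ r) (by positivity)
    (fun m hm => hJ.cellAvg_sub_le hr hh hx hm) s 0 hr (1 / 2) (by norm_num)
  have h2 := hJ.taylor_scaled (S := r + 1) (ξ := 1 / 2)
    (by rw [abs_of_pos (by norm_num)]; linarith [(r.cast_nonneg : (0 : ℝ) ≤ r)]) hh hx
  rw [mul_one_div, abs_sub_comm] at h2
  rw [hve, subValue, subPoly_add, subPoly_primitive r s Q (natDegree_primPoly_le _ _), eval_add]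
  rw [Function.iterate_zero, id] at h1
  calc _ = |(subPoly r s e).eval (1 / 2) + ((derivative Q).eval (1 / 2) - u (x + h / 2))| := by
        ring_nf
    _ ≤ _ := abs_add_le _ _
    _ ≤ _ := add_le_add h1 h2
    _ = _ := by ring

/-- The error, at the right interface, of the linear scheme on the averages of `Q'`. -/
noncomputable def linearError (r : ℕ) (Q : ℝ[X]) : ℝ :=
  ∑ s, optWeight r s *
    subValue r s (fun m : ℤ => Q.eval ((m : ℝ) + 1 / 2) - Q.eval ((m : ℝ) - 1 / 2))
    - (derivative Q).eval (1 / 2)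

lemma subValue_add {r : ℕ} (s : Fin r) (v w : ℤ → ℝ) :
    subValue r s (fun m => v m + w m) = subValue r s v + subValue r s w := by
  rw [subValue, subPoly_add, eval_add, subValue, subValue]

lemma subValue_const_mul {r : ℕ} (s : Fin r) (b : ℝ) (v : ℤ → ℝ) :
    subValue r s (fun m => b * v m) = b * subValue r s v := by
  simp only [subValue, subPoly, reconPoly_eq_sum, ← mul_sum, C_mul, mul_assoc, eval_mul, eval_C]

lemma linearError_add_C_mul (r : ℕ) (Q S : ℝ[X]) (b : ℝ) :
    linearError r (Q + C b * S) = linearError r Q + b * linearError r S := by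
  have h : (fun m : ℤ => (Q + C b * S).eval ((m : ℝ) + 1 / 2) -
      (Q + C b * S).eval ((m : ℝ) - 1 / 2)) =
      fun m : ℤ => (Q.eval ((m : ℝ) + 1 / 2) - Q.eval ((m : ℝ) - 1 / 2)) +
        b * (S.eval ((m : ℝ) + 1 / 2) - S.eval ((m : ℝ) - 1 / 2)) := by
    funext m
    simp only [eval_add, eval_C_mul]; ring
  simp only [linearError, h, subValue_add]
  simp only [subValue_const_mul, mul_add, sum_add_distrib, derivative_add, derivative_C_mul,
    eval_add, eval_C_mul, mul_left_comm _ b, ← mul_sum]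
  ring

/-- The leading error term of the linear scheme. -/
lemma JetOn.exists_linear_expansion {u : ℝ → ℝ} {x₀ R M : ℝ} {r : ℕ} (hr : 0 < r)
    (hJ : JetOn u x₀ R M (2 * r)) (hM : 0 ≤ M) :
    ∃ κ : ℝ, ∃ K ≥ 0, ∀ h, 0 < h → ∀ x, |x - x₀| + (r + 1) * h < R →
      |∑ s, optWeight r s * subValue r s (fun m : ℤ => cellAvg u h (x + m * h)) - u (x + h / 2)
        - κ * iteratedDeriv (2 * r - 1) u x * h ^ (2 * r - 1)| ≤ K * h ^ (2 * r) := by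
  obtain ⟨K₁, hK₁, hstab⟩ := exists_subPoly_bound r
  refine ⟨linearError r (X ^ (2 * r)) / (2 * r).factorial,
    K₁ * (M * (r + 1) ^ (2 * r)) + M * (r + 1) ^ (2 * r), by positivity, fun h hh x hx => ?_⟩
  set Q := primPoly (scaledJet u h x) (2 * r) with hQ
  set w : ℤ → ℝ := fun m => Q.eval ((m : ℝ) + 1 / 2) - Q.eval ((m : ℝ) - 1 / 2) with hw
  set e : ℤ → ℝ := fun m => cellAvg u h (x + m * h) - w m with he
  have hve : (fun m : ℤ => cellAvg u h (x + m * h)) = fun m => w m + e m := by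
    funext m; simp [he]
  -- Exactness removes all but the top monomial of the primitive, whose coefficient carries
  -- `u^(2r-1)(x) * h ^ (2 r - 1)`.
  have hlin : linearError r Q = scaledJet u h x (2 * r - 1) / (2 * r).factorial *
      linearError r (X ^ (2 * r)) := by
    have h1 : Q = primPoly (scaledJet u h x) (2 * r - 1) +
        C (scaledJet u h x (2 * r - 1) / (2 * r).factorial) * X ^ (2 * r) := by
      have := primPoly_succ (scaledJet u h x) (2 * r - 1)
      rwa [Nat.sub_add_cancel (by omega)] at this
    rw [h1, linearError_add_C_mul, linearError,
      sum_optWeight_mul_subValue hr _ (natDegree_primPoly_le _ _), sub_self, zero_add]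
  have h1 : |∑ s, optWeight r s * subValue r s e| ≤ K₁ * (M * (r + 1) ^ (2 * r) * h ^ (2 * r)) := by
    refine (abs_sum_le_sum_abs _ _).trans ?_
    calc _ ≤ ∑ s, optWeight r s * (K₁ * (M * (r + 1) ^ (2 * r) * h ^ (2 * r))) := by
          refine sum_le_sum fun s _ => ?_
          rw [abs_mul, abs_of_pos (optWeight_pos s)]
          refine mul_le_mul_of_nonneg_left ?_ (optWeight_pos s).le
          exact hstab e _ (by positivity)
            (fun m hm => hJ.cellAvg_sub_le (by omega) hh hx hm) s 0 hr (1 / 2) (by norm_num)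
      _ = _ := by rw [← sum_mul, sum_optWeight hr, one_mul]
  have h2 := hJ.taylor_scaled (S := r + 1) (ξ := 1 / 2)
    (by rw [abs_of_pos (by norm_num)]; linarith [(r.cast_nonneg : (0 : ℝ) ≤ r)]) hh hx
  rw [mul_one_div, abs_sub_comm] at h2
  have hsplit : ∑ s, optWeight r s * subValue r s (fun m : ℤ => cellAvg u h (x + m * h)) =
      linearError r Q + (derivative Q).eval (1 / 2) + ∑ s, optWeight r s * subValue r s e := by
    rw [hve]
    simp only [subValue_add, mul_add, sum_add_distrib, linearError, hw]
    ring
  calc _ = |∑ s, optWeight r s * subValue r s e +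
        ((derivative Q).eval (1 / 2) - u (x + h / 2))| := by
        rw [hsplit, hlin, scaledJet]; congr 1; ring
    _ ≤ _ := abs_add_le _ _
    _ ≤ _ := add_le_add h1 h2
    _ = _ := by ring

/-- The error of the reconstruction is a Lipschitz function times `h ^ (2 r - 1)`, up to
`O(h ^ (2 r))`, uniformly in `ε`. -/
theorem exists_uMinus_expansion {r n k : ℕ} (hn : n + 1 < r) (hk : kMAIM r n ≤ (k : ℝ))
    {A δ εA : ℝ} (hA : 0 < A) (hδ : 0 < δ) (hεA : 0 ≤ εA) (T : AdaType r)
    (hT : T.Admissible k) {u : ℝ → ℝ} {x₀ : ℝ} (hu : ContDiffAt ℝ ∞ u x₀)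
    (hcp : iteratedDeriv (n + 1) u x₀ ≠ 0) :
    ∃ D : ℝ → ℝ, ∃ K > 0, ∃ ρ > 0, ∃ h₀ > 0,
      (∀ x, |x - x₀| ≤ ρ → |D x| ≤ K) ∧
      (∀ x y, |x - x₀| ≤ ρ → |y - x₀| ≤ ρ → |D x - D y| ≤ K * |x - y|) ∧
      ∀ ε ≥ 0, ∀ h, 0 < h → h < h₀ → ∀ x, |x - x₀| ≤ ρ →
        |uMinus (r := r) ⟨k, A, δ, ε, εA, T⟩ u h x - u (x + h / 2) - D x * h ^ (2 * r - 1)|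
          ≤ K * h ^ (2 * r) := by
  obtain ⟨R₁, hR₁, M, hM, hJ₁⟩ := exists_jetOn hu (2 * r)
  obtain ⟨R₂, hR₂, hR₂b⟩ : ∃ R₂ > 0, ∀ x, |x - x₀| < R₂ →
      |iteratedDeriv (n + 1) u x₀| / 2 ≤ |iteratedDeriv (n + 1) u x| := by
    have hpos : 0 < |iteratedDeriv (n + 1) u x₀| := abs_pos.2 hcp
    have : ∀ᶠ x in nhds x₀,
        |iteratedDeriv (n + 1) u x₀| / 2 < |iteratedDeriv (n + 1) u x| :=
      ((contDiffAt_iteratedDeriv hu (n + 1)).continuousAt.abs).eventually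
        (lt_mem_nhds (by linarith))
    obtain ⟨R₂, hR₂, h⟩ := Metric.eventually_nhds_iff.1 this
    exact ⟨R₂, hR₂, fun x hx => (h (by simpa [Real.dist_eq] using hx)).le⟩
  set R := min R₁ R₂ with hR
  have hR0 : 0 < R := lt_min hR₁ hR₂
  have hJ := hJ₁.mono_radius (min_le_left R₁ R₂)
  have hJr : JetOn u x₀ R M r := hJ.mono (by omega)
  obtain ⟨K₁, hK₁, h₁, hh₁, hW⟩ := hJr.weightMAIM_close hM.le hn hk
    (half_pos (abs_pos.2 hcp)) (fun x hx => hR₂b x (hx.trans_le (min_le_right _ _)))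
    hA hδ hεA T hT
  obtain ⟨K₂, hK₂, hV⟩ := hJr.exists_subValue_close hM.le
  obtain ⟨κ, K₃, hK₃, hL⟩ := hJ.exists_linear_expansion (by omega) hM.le
  have hρ : ∀ x, |x - x₀| ≤ R / 2 → |x - x₀| < R := fun x hx => by linarith
  -- The jet is controlled up to order `2 r`, one more than `D` uses, so that `D` is Lipschitz.
  refine ⟨fun x => κ * iteratedDeriv (2 * r - 1) u x, |κ| * M + (r * (K₁ * K₂) + K₃) + 1,
    by positivity, R / 2, by positivity, min h₁ (R / (2 * (r + 1))), by positivity, ?_, ?_, ?_⟩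
  · intro x hx
    rw [abs_mul]
    have : |κ| * |iteratedDeriv (2 * r - 1) u x| ≤ |κ| * M := by
      gcongr; exact hJ.bound _ (by omega) x (hρ x hx)
    have : 0 ≤ r * (K₁ * K₂) + K₃ := by positivity
    linarith
  · intro x y hx hy
    have hmem : ∀ z, z ∈ Metric.closedBall x₀ (R / 2) ↔ |z - x₀| ≤ R / 2 := fun z => by
      rw [Metric.mem_closedBall, Real.dist_eq]
    have hlip := Convex.norm_image_sub_le_of_norm_hasDerivWithin_le
      (s := Metric.closedBall x₀ (R / 2)) (f := iteratedDeriv (2 * r - 1) u)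
      (f' := iteratedDeriv (2 * r - 1 + 1) u) (C := M)
      (fun z hz => (hJ.hasDerivAt (2 * r - 1) (by omega) z
        (hρ z ((hmem z).1 hz))).hasDerivWithinAt)
      (fun z hz => hJ.bound (2 * r - 1 + 1) (by omega) z (hρ z ((hmem z).1 hz)))
      (convex_closedBall _ _) ((hmem y).2 hy) ((hmem x).2 hx)
    rw [← mul_sub, abs_mul]
    rw [Real.norm_eq_abs, Real.norm_eq_abs] at hlip
    calc _ ≤ |κ| * (M * |x - y|) := by gcongr
      _ = (|κ| * M) * |x - y| := by ring
      _ ≤ _ := by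
        gcongr
        have : 0 ≤ r * (K₁ * K₂) + K₃ := by positivity
        linarith
  · intro ε hε h hh hlt x hx
    have hx' : |x - x₀| + (r + 1) * h < R := by
      have := hlt.trans_le (min_le_right _ _)
      rw [lt_div_iff₀ (by positivity)] at this
      linarith
    obtain ⟨hsum, hclose⟩ := hW ε hε h hh (hlt.trans_le (min_le_left _ _)) x hx'
    rw [uMinus, recon_eq_of_sum_weight _ _ (by omega) hsum (u (x + h / 2)), add_sub_assoc]
    refine (abs_add_le _ _).trans ?_
    -- Weight deviation `O(h ^ r)` times substencil error `O(h ^ r)`: the nonlinearity leaves the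
    -- leading term untouched, as the later division by `h` requires.
    have hnl : |∑ s, (weightMAIM (r := r) ⟨k, A, δ, ε, εA, T⟩
        (fun m : ℤ => cellAvg u h (x + m * h)) s - optWeight r s) *
        (subValue r s (fun m : ℤ => cellAvg u h (x + m * h)) - u (x + h / 2))| ≤
        r * (K₁ * K₂) * h ^ (2 * r) := by
      refine (abs_sum_le_sum_abs _ _).trans ?_
      calc _ ≤ ∑ s : Fin r, (K₁ * h ^ r) * (K₂ * h ^ r) := sum_le_sum fun s _ => by
            rw [abs_mul]
            exact mul_le_mul (hclose s) (hV h hh x hx' s) (abs_nonneg _) (by positivity)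
        _ = _ := by
          rw [sum_const, card_univ, Fintype.card_fin, nsmul_eq_mul]; ring
    have := add_le_add hnl (hL h hh x hx')
    refine this.trans ?_
    rw [← add_mul]
    refine mul_le_mul_of_nonneg_right ?_ (by positivity)
    have : 0 ≤ |κ| * M := by positivity
    linarith

end WENO
namespace WENO

open Finset

/-! ### The right-biased value and the numerical flux -/

lemma cellAvg_neg (u : ℝ → ℝ) (h x : ℝ) : cellAvg (fun y => u (-y)) h (-x) = cellAvg u h x := by
  rw [cellAvg, cellAvg, intervalIntegral.integral_comp_neg]
  congr 2 <;> ring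

/-- The reflection `y ↦ -y` exchanges the two biases and sends the centre `x + h` of the right cell
to `-(x + h)`. -/
lemma uPlus_eq_uMinus_neg {r : ℕ} (P : Params r) (u : ℝ → ℝ) (h x : ℝ) :
    uPlus P u h x = uMinus P (fun y => u (-y)) h (-(x + h)) := by
  rw [uPlus, uMinus]
  congr 1
  funext m
  rw [← cellAvg_neg u]
  congr 1
  ring

/-- A `C²` function is locally bounded in `C^{1,1}`. -/
lemma exists_local_linearization {f : ℝ → ℝ} (hf : ContDiff ℝ 2 f) (y₀ : ℝ) :
    ∃ L > 0, ∃ σ > 0, ∀ w, |w - y₀| < σ → ∀ a, |a - y₀| < σ →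
      |deriv f w| ≤ L ∧ |deriv f a - deriv f w| ≤ L * |a - w| ∧
      |f a - f w - deriv f w * (a - w)| ≤ L * |a - w| ^ 2 := by
  have hd : ContDiff ℝ 1 (deriv f) := hf.deriv'
  obtain ⟨k, t, ht, hlip⟩ := (hd.contDiffAt (x := y₀)).exists_lipschitzOnWith
  have hb : ∀ᶠ w in nhds y₀, |deriv f w| < |deriv f y₀| + 1 :=
    (hd.continuous.continuousAt.abs).eventually (gt_mem_nhds (lt_add_one _))
  obtain ⟨σ, hσ, h⟩ := Metric.eventually_nhds_iff.1 (hb.and ht)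
  have hk : (0 : ℝ) ≤ k := k.2
  have hL : ∀ w, |w - y₀| < σ → ∀ a, |a - y₀| < σ →
      |deriv f a - deriv f w| ≤ (|deriv f y₀| + 1 + k) * |a - w| := by
    intro w hw a ha
    have := hlip.dist_le_mul a (h (by simpa [Real.dist_eq] using ha)).2 w
      (h (by simpa [Real.dist_eq] using hw)).2
    rw [Real.dist_eq, Real.dist_eq] at this
    refine this.trans ?_
    gcongr
    linarith [abs_nonneg (deriv f y₀)]
  refine ⟨|deriv f y₀| + 1 + k, by positivity, σ, hσ, fun w hw a ha => ⟨?_, hL w hw a ha, ?_⟩⟩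
  · linarith [(h (y := w) (by simpa [Real.dist_eq] using hw)).1]
  · have hsub : ∀ z ∈ Set.uIcc w a, |z - y₀| < σ := by
      intro z hz
      have hb : Set.uIcc w a ⊆ Metric.ball y₀ σ :=
        ((convex_ball y₀ σ).ordConnected).uIcc_subset (by simpa [Real.dist_eq] using hw)
          (by simpa [Real.dist_eq] using ha)
      simpa [Real.dist_eq] using hb hz
    -- The quadratic remainder is the mean value inequality for `f` minus its linear part at `w`.
    have hder : ∀ z ∈ Set.uIcc w a, HasDerivWithinAt (fun z => f z - deriv f w * z)
        (deriv f z - deriv f w) (Set.uIcc w a) z := by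
      intro z _
      have h1 : HasDerivAt f (deriv f z) z := (hf.differentiable (by simp) z).hasDerivAt
      have h2 := h1.sub ((hasDerivAt_id z).const_mul (deriv f w))
      rw [mul_one] at h2
      exact h2.hasDerivWithinAt
    have := Convex.norm_image_sub_le_of_norm_hasDerivWithin_le hder
      (C := (|deriv f y₀| + 1 + k) * |a - w|)
      (fun z hz => (hL w hw z (hsub z hz)).trans (by
        have := Set.abs_sub_left_of_mem_uIcc hz
        gcongr)) (convex_uIcc w a) Set.left_mem_uIcc Set.right_mem_uIcc
    rw [Real.norm_eq_abs, Real.norm_eq_abs] at this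
    calc _ = |f a - deriv f w * a - (f w - deriv f w * w)| := by congr 1; ring
      _ ≤ _ := this
      _ = _ := by ring

/-- The leading error term of the Lax–Friedrichs flux. -/
lemma fluxLF_expansion {f : ℝ → ℝ} {α a b w p D₁ D₂ H η K L : ℝ} (hL : 0 ≤ L)
    (hp : |p| ≤ L) (hfa : |f a - f w - p * (a - w)| ≤ L * |a - w| ^ 2)
    (hfb : |f b - f w - p * (b - w)| ≤ L * |b - w| ^ 2)
    (ha : |a - w - D₁ * H| ≤ K * η) (hb : |b - w - D₂ * H| ≤ K * η)
    (ha' : |a - w| ≤ 2 * K * H) (hb' : |b - w| ≤ 2 * K * H) (hη : H ^ 2 ≤ η) :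
    |fluxLF f α a b - f w - (1 / 2 * (p * (D₁ + D₂)) - α / 2 * (D₂ - D₁)) * H| ≤
      (4 * L * K ^ 2 + L * K + |α| * K) * η := by
  have hsq : ∀ z, |z| ≤ 2 * K * H → L * |z| ^ 2 ≤ 4 * L * K ^ 2 * η := by
    intro z hz
    calc L * |z| ^ 2 ≤ L * (2 * K * H) ^ 2 := by gcongr
      _ = 4 * L * K ^ 2 * H ^ 2 := by ring
      _ ≤ _ := by gcongr
  have h1 := hfa.trans (hsq _ ha')
  have h2 := hfb.trans (hsq _ hb')
  have h3 : |p * (a - w - D₁ * H)| ≤ L * (K * η) := by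
    rw [abs_mul]; exact mul_le_mul hp ha (abs_nonneg _) hL
  have h4 : |p * (b - w - D₂ * H)| ≤ L * (K * η) := by
    rw [abs_mul]; exact mul_le_mul hp hb (abs_nonneg _) hL
  have h5 : |α * ((b - w - D₂ * H) - (a - w - D₁ * H))| ≤ |α| * (K * η + K * η) := by
    rw [abs_mul]
    exact mul_le_mul_of_nonneg_left ((abs_sub _ _).trans (add_le_add hb ha)) (abs_nonneg α)
  -- An exact splitting into two quadratic remainders of `f`, two expansion errors weighted by `p`,
  -- and the dissipation error.
  have heq : fluxLF f α a b - f w - (1 / 2 * (p * (D₁ + D₂)) - α / 2 * (D₂ - D₁)) * H =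
      1 / 2 * ((f a - f w - p * (a - w)) + (f b - f w - p * (b - w)) + p * (a - w - D₁ * H) +
        p * (b - w - D₂ * H) - α * ((b - w - D₂ * H) - (a - w - D₁ * H))) := by
    rw [fluxLF]; ring
  rw [heq]
  rw [abs_le] at *
  constructor <;> nlinarith

/-- The leading error coefficient of the flux varies by `O(h)` between neighbouring interfaces. -/
lemma fluxCoeff_sub_le {α p p' D₁ D₂ D₁' D₂' K L V h : ℝ} (hL : 0 ≤ L)
    (hp : |p - p'| ≤ L * (V * h)) (hp' : |p'| ≤ L) (h1 : |D₁| ≤ K) (h2 : |D₂| ≤ K)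
    (h1' : |D₁ - D₁'| ≤ K * h) (h2' : |D₂ - D₂'| ≤ K * h) :
    |(1 / 2 * (p * (D₁ + D₂)) - α / 2 * (D₂ - D₁)) -
      (1 / 2 * (p' * (D₁' + D₂')) - α / 2 * (D₂' - D₁'))| ≤
      (L * V * K + L * K + |α| * K) * h := by
  have e1 : |(p - p') * (D₁ + D₂)| ≤ L * (V * h) * (K + K) := by
    rw [abs_mul]
    exact mul_le_mul hp ((abs_add_le _ _).trans (add_le_add h1 h2)) (abs_nonneg _)
      ((abs_nonneg _).trans hp)
  have e2 : |p' * ((D₁ - D₁') + (D₂ - D₂'))| ≤ L * (K * h + K * h) := by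
    rw [abs_mul]
    exact mul_le_mul hp' ((abs_add_le _ _).trans (add_le_add h1' h2')) (abs_nonneg _) hL
  have e3 : |α * ((D₂ - D₂') - (D₁ - D₁'))| ≤ |α| * (K * h + K * h) := by
    rw [abs_mul]
    exact mul_le_mul_of_nonneg_left ((abs_sub _ _).trans (add_le_add h2' h1')) (abs_nonneg α)
  have heq : (1 / 2 * (p * (D₁ + D₂)) - α / 2 * (D₂ - D₁)) -
      (1 / 2 * (p' * (D₁' + D₂')) - α / 2 * (D₂' - D₁')) =
      1 / 2 * ((p - p') * (D₁ + D₂) + p' * ((D₁ - D₁') + (D₂ - D₂')) -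
        α * ((D₂ - D₂') - (D₁ - D₁'))) := by ring
  rw [heq]
  rw [abs_le] at e1 e2 e3 ⊢
  constructor <;> nlinarith

/-- Cancellation of the leading error terms in the divided difference of the flux. -/
lemma abs_divided_difference_sub_le {F F' w w' G G' H h C₁ C₂ : ℝ} (hh : 0 < h) (hH : 0 ≤ H)
    (h1 : |F - w - G * H| ≤ C₁ * (h * H)) (h2 : |F' - w' - G' * H| ≤ C₁ * (h * H))
    (hG : |G - G'| ≤ C₂ * h) :
    |-(1 / h) * (F - F') - -(1 / h) * (w - w')| ≤ (C₂ + 2 * C₁) * H := by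
  have heq : -(1 / h) * (F - F') - -(1 / h) * (w - w') =
      -(((F - w - G * H) - (F' - w' - G' * H) + (G - G') * H) / h) := by ring
  have hGH : |(G - G') * H| ≤ C₂ * h * H := by
    rw [abs_mul, abs_of_nonneg hH]; gcongr
  rw [heq, abs_neg, abs_div, abs_of_pos hh, div_le_iff₀ hh]
  refine ((abs_add_le _ _).trans
    (add_le_add ((abs_sub _ _).trans (add_le_add h1 h2)) hGH)).trans (le_of_eq ?_)
  ring

/-- The expansions of both one-sided values, with common constants. -/
theorem exists_uMinus_uPlus_expansion {r n k : ℕ} (hn : n + 1 < r) (hk : kMAIM r n ≤ (k : ℝ))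
    {A δ εA : ℝ} (hA : 0 < A) (hδ : 0 < δ) (hεA : 0 ≤ εA) (T : AdaType r)
    (hT : T.Admissible k) {u : ℝ → ℝ} {x₀ : ℝ} (hu : ContDiffAt ℝ ∞ u x₀)
    (hcp : iteratedDeriv (n + 1) u x₀ ≠ 0) :
    ∃ D D' : ℝ → ℝ, ∃ K > 0, ∃ ρ > 0, ∃ h₀ > 0,
      (∀ x, |x - x₀| ≤ ρ → |D x| ≤ K ∧ |D' x| ≤ K) ∧
      (∀ x y, |x - x₀| ≤ ρ → |y - x₀| ≤ ρ →
        |D x - D y| ≤ K * |x - y| ∧ |D' x - D' y| ≤ K * |x - y|) ∧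
      ∀ ε ≥ 0, ∀ h, 0 < h → h < h₀ → ∀ x, |x - x₀| ≤ ρ → |x + h - x₀| ≤ ρ →
        |uMinus (r := r) ⟨k, A, δ, ε, εA, T⟩ u h x - u (x + h / 2) - D x * h ^ (2 * r - 1)|
          ≤ K * h ^ (2 * r) ∧
        |uPlus (r := r) ⟨k, A, δ, ε, εA, T⟩ u h x - u (x + h / 2) - D' (x + h) * h ^ (2 * r - 1)|
          ≤ K * h ^ (2 * r) := by
  obtain ⟨D, K₁, hK₁, ρ₁, hρ₁, h₁, hh₁, hDb, hDl, hexp⟩ :=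
    exists_uMinus_expansion hn hk hA hδ hεA T hT hu hcp
  have hu' : ContDiffAt ℝ ∞ (fun y => u (-y)) (-x₀) := by
    have hneg : ContDiffAt ℝ ∞ (fun y : ℝ => -y) (-x₀) := contDiff_neg.contDiffAt
    exact ContDiffAt.comp (g := u) (-x₀) (by simpa using hu) hneg
  have hcp' : iteratedDeriv (n + 1) (fun y => u (-y)) (-x₀) ≠ 0 := by
    rw [iteratedDeriv_comp_neg, neg_neg]
    exact smul_ne_zero (pow_ne_zero _ (by norm_num)) hcp
  -- The left-biased expansion of the reflected function; its coefficient, reflected back, is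
  -- evaluated at `x + h`, the centre of the right-biased stencil.
  obtain ⟨D', K₂, hK₂, ρ₂, hρ₂, h₂, hh₂, hDb', hDl', hexp'⟩ :=
    exists_uMinus_expansion hn hk hA hδ hεA T hT hu' hcp'
  have hneg : ∀ y z : ℝ, |-y - -z| = |y - z| := fun y z => by
    rw [← abs_neg, show -(-y - -z) = y - z by ring]
  have hρ1 := min_le_left ρ₁ ρ₂
  have hρ2 := min_le_right ρ₁ ρ₂
  have hK1 := le_max_left K₁ K₂
  have hK2 := le_max_right K₁ K₂
  have hneg' : ∀ y, |y - x₀| ≤ min ρ₁ ρ₂ → |-y - -x₀| ≤ ρ₂ := fun y hy =>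
    (hneg y x₀).le.trans (hy.trans hρ2)
  refine ⟨D, fun x => D' (-x), max K₁ K₂, lt_max_of_lt_left hK₁, min ρ₁ ρ₂, lt_min hρ₁ hρ₂,
    min h₁ h₂, lt_min hh₁ hh₂, fun x hx => ⟨(hDb x (hx.trans hρ1)).trans hK1,
      (hDb' (-x) (hneg' x hx)).trans hK2⟩, fun x y hx hy => ⟨?_, ?_⟩, ?_⟩
  · exact (hDl x y (hx.trans hρ1) (hy.trans hρ1)).trans (by gcongr)
  · have := hDl' (-x) (-y) (hneg' x hx) (hneg' y hy)
    rw [hneg] at this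
    exact this.trans (by gcongr)
  · intro ε hε h hh hlt x hx hxh
    refine ⟨(hexp ε hε h hh (hlt.trans_le (min_le_left _ _)) x (hx.trans hρ1)).trans
      (by gcongr), ?_⟩
    have := hexp' ε hε h hh (hlt.trans_le (min_le_right _ _)) (-(x + h)) (hneg' _ hxh)
    rw [← uPlus_eq_uMinus_neg, show -(-(x + h) + h / 2) = x + h / 2 by ring] at this
    exact this.trans (by gcongr)

lemma exists_local_lipschitz {u : ℝ → ℝ} {x₀ : ℝ} (hu : ContDiffAt ℝ ∞ u x₀) :
    ∃ V > 0, ∃ R > 0, ∀ y z, |y - x₀| < R → |z - x₀| < R → |u y - u z| ≤ V * |y - z| := by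
  obtain ⟨R, hR, V, hV, hJ⟩ := exists_jetOn hu 1
  refine ⟨V, hV, R, hR, fun y z hy hz => ?_⟩
  have := taylor_bound x₀ R V 1 (fun l => iteratedDeriv l u) hJ.hasDerivAt
    (hJ.bound 1 le_rfl) z y hz hy
  simpa using this

lemma abs_add_sub_le_of_half {x x₀ t τ : ℝ} (hx : |x - x₀| ≤ τ / 2) (ht : |t| ≤ τ / 2) :
    |x + t - x₀| ≤ τ := by
  have := abs_add_le (x - x₀) t
  rw [show x - x₀ + t = x + t - x₀ by ring] at this
  linarith

lemma abs_le_two_mul_of_expansion {z d K H η : ℝ} (hK : 0 ≤ K) (hH : 0 ≤ H) (hη : η ≤ H)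
    (hz : |z - d * H| ≤ K * η) (hd : |d| ≤ K) : |z| ≤ 2 * K * H := by
  have h1 : |d * H| ≤ K * H := by rw [abs_mul, abs_of_nonneg hH]; gcongr
  have h2 : K * η ≤ K * H := by gcongr
  have h3 : |z| ≤ |z - d * H| + |d * H| := by
    simpa using abs_add_le (z - d * H) (d * H)
  linarith

end WENO

/-- The constants are uniform in `ε ≥ 0` and in the position of the grid near `x₀`. -/
theorem mainTheorem2 (r n k : ℕ) (hn : n + 1 < r) (hk1 : 1 ≤ k) (hk : WENO.kMAIM r n ≤ (k : ℝ))
    (A δ εA : ℝ) (hA : 0 < A) (hδ : 0 < δ) (hεA : 0 ≤ εA)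
    (T : WENO.AdaType r) (hT : T.Admissible k)
    (u : ℝ → ℝ) (x₀ : ℝ) (hu : ContDiffAt ℝ ∞ u x₀) (hcp : WENO.IsCritOrder u x₀ n)
    (f : ℝ → ℝ) (hf : ContDiff ℝ 2 f) (α : ℝ) :
    ∃ K > 0, ∃ ρ > 0, ∃ h₀ > 0, ∀ ε ≥ 0, ∀ h, 0 < h → h < h₀ → ∀ x, |x - x₀| ≤ ρ →
      |WENO.uMinus (r := r) ⟨k, A, δ, ε, εA, T⟩ u h x - u (x + h / 2)| ≤ K * h ^ (2 * r - 1) ∧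
      |WENO.uPlus (r := r) ⟨k, A, δ, ε, εA, T⟩ u h x - u (x + h / 2)| ≤ K * h ^ (2 * r - 1) ∧
      |WENO.spatialOp (r := r) ⟨k, A, δ, ε, εA, T⟩ f α u h x - WENO.exactOp f u h x|
        ≤ K * h ^ (2 * r - 1) := by
  obtain ⟨D, D', K, hK, ρ, hρ, h₁, hh₁, hDb, hDl, hexp⟩ :=
    WENO.exists_uMinus_uPlus_expansion hn hk hA hδ hεA T hT hu hcp.2
  obtain ⟨V, hV, R, hR, hulip⟩ := WENO.exists_local_lipschitz hu
  obtain ⟨L, hL, σ, hσ, hlin⟩ := WENO.exists_local_linearization hf (u x₀)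
  -- all points that occur lie within `τ` of `x₀`
  obtain ⟨τ, hτ, hτρ, hτR, hτσ⟩ : ∃ τ > 0, τ ≤ ρ ∧ τ < R ∧ V * τ ≤ σ / 4 := by
    refine ⟨min ρ (min (R / 2) (σ / (4 * V))), by positivity, min_le_left _ _, ?_, ?_⟩
    · exact ((min_le_right _ _).trans (min_le_left _ _)).trans_lt (half_lt_self hR)
    · have : min ρ (min (R / 2) (σ / (4 * V))) ≤ σ / (4 * V) :=
        (min_le_right _ _).trans (min_le_right _ _)
      rw [le_div_iff₀ (by positivity)] at this
      linarith
  have hunear : ∀ y, |y - x₀| ≤ τ → |u y - u x₀| ≤ σ / 4 := fun y hy =>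
    (hulip y x₀ (hy.trans_lt hτR) (by simpa using hR)).trans
      ((mul_le_mul_of_nonneg_left hy hV.le).trans hτσ)
  have hws : ∀ y, |y - x₀| ≤ τ → |u y - u x₀| < σ := fun y hy =>
    (hunear y hy).trans_lt (by linarith only [hσ])
  obtain ⟨C₁, hC₁⟩ : ∃ C, C = 4 * L * K ^ 2 + L * K + |α| * K := ⟨_, rfl⟩
  obtain ⟨C₂, hC₂⟩ : ∃ C, C = L * V * K + L * K + |α| * K := ⟨_, rfl⟩
  have hC₁0 : 0 ≤ C₁ := by rw [hC₁]; positivity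
  have hC₂0 : 0 ≤ C₂ := by rw [hC₂]; positivity
  -- `2 * K` serves the one-sided values and `C₂ + 2 * C₁` the flux difference. The bound `σ / (8 *
  -- K)` on `h` keeps the reconstructed values within `σ` of `u x₀`, where `f` is linearized.
  refine ⟨2 * K + (C₂ + 2 * C₁), by positivity, τ / 2, by positivity,
    min h₁ (min (min 1 (τ / 2)) (σ / (8 * K))), by positivity, ?_⟩
  intro ε hε h hh hlt x hx
  have hlt1 : h < h₁ := hlt.trans_le (min_le_left _ _)
  have hle1 : h ≤ 1 :=
    (hlt.trans_le ((min_le_right _ _).trans ((min_le_left _ _).trans (min_le_left _ _)))).le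
  have hleτ : h ≤ τ / 2 :=
    (hlt.trans_le ((min_le_right _ _).trans ((min_le_left _ _).trans (min_le_right _ _)))).le
  have hleσ : h * (8 * K) < σ := by
    have := hlt.trans_le ((min_le_right _ _).trans (min_le_right _ _))
    rwa [lt_div_iff₀ (by positivity)] at this
  specialize hexp ε hε h hh hlt1
  generalize (⟨k, A, δ, ε, εA, T⟩ : WENO.Params r) = P at hexp ⊢
  have hη : h ^ (2 * r) = h * h ^ (2 * r - 1) := by
    rw [← pow_succ', Nat.sub_add_cancel (by omega)]
  have hHh : h ^ (2 * r - 1) ≤ h := by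
    simpa using pow_le_pow_of_le_one hh.le hle1 (show 1 ≤ 2 * r - 1 by omega)
  have hH0 : 0 < h ^ (2 * r - 1) := by positivity
  rw [hη] at hexp
  generalize h ^ (2 * r - 1) = H at hexp hHh hH0 ⊢
  have hηH : h * H ≤ H := mul_le_of_le_one_left hH0.le hle1
  have hH2 : H ^ 2 ≤ h * H := by rw [sq]; gcongr
  have hKH : 2 * K * H ≤ σ / 4 := by
    have := mul_le_mul_of_nonneg_left hHh hK.le
    linarith only [this, hleσ]
  have hpoint : ∀ y, |y - x₀| ≤ τ → |y + h - x₀| ≤ τ →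
      |WENO.uMinus P u h y - u (y + h / 2)| ≤ 2 * K * H ∧
      |WENO.uPlus P u h y - u (y + h / 2)| ≤ 2 * K * H := fun y hy hy' =>
    have e := hexp y (hy.trans hτρ) (hy'.trans hτρ)
    ⟨WENO.abs_le_two_mul_of_expansion hK.le hH0.le hηH e.1 (hDb y (hy.trans hτρ)).1,
      WENO.abs_le_two_mul_of_expansion hK.le hH0.le hηH e.2 (hDb _ (hy'.trans hτρ)).2⟩
  have hflux : ∀ y, |y - x₀| ≤ τ → |y + h - x₀| ≤ τ → |y + h / 2 - x₀| ≤ τ →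
      |WENO.numFlux P f α u h y - f (u (y + h / 2)) -
        (1 / 2 * (deriv f (u (y + h / 2)) * (D y + D' (y + h))) -
          α / 2 * (D' (y + h) - D y)) * H| ≤ C₁ * (h * H) := by
    intro y hy hy' hy''
    obtain ⟨e1, e2⟩ := hexp y (hy.trans hτρ) (hy'.trans hτρ)
    obtain ⟨e3, e4⟩ := hpoint y hy hy'
    have hw := hunear _ hy''
    have hnear : ∀ a, |a - u (y + h / 2)| ≤ 2 * K * H → |a - u x₀| < σ := by
      intro a ha
      have := abs_sub_le a (u (y + h / 2)) (u x₀)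
      linarith only [this, ha, hKH, hw, hσ]
    have l1 := hlin _ (hws _ hy'') _ (hnear _ e3)
    have l2 := hlin _ (hws _ hy'') _ (hnear _ e4)
    rw [hC₁]
    exact WENO.fluxLF_expansion hL.le l1.1 l1.2.2 l2.2.2 e1 e2 e3 e4 hH2
  have hx0 : |x - x₀| ≤ τ := hx.trans (half_le_self hτ.le)
  have hh2 : |h / 2| ≤ τ / 2 := by
    rw [abs_of_pos (half_pos hh)]; exact (half_le_self hh.le).trans hleτ
  have hxp : |x + h - x₀| ≤ τ := WENO.abs_add_sub_le_of_half hx (by rwa [abs_of_pos hh])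
  have hxm : |x - h - x₀| ≤ τ :=
    WENO.abs_add_sub_le_of_half hx (by rwa [abs_neg, abs_of_pos hh])
  have hxph : |x + h / 2 - x₀| ≤ τ := WENO.abs_add_sub_le_of_half hx hh2
  have hmid : x - h + h / 2 = x + -(h / 2) := by ring
  have hxmh : |x - h + h / 2 - x₀| ≤ τ := by
    rw [hmid]; exact WENO.abs_add_sub_le_of_half hx (by rwa [abs_neg])
  have hxmp : |x - h + h - x₀| ≤ τ := by rwa [sub_add_cancel]
  obtain ⟨hminus, hplus⟩ := hpoint x hx0 hxp
  have hKle : 2 * K * H ≤ (2 * K + (C₂ + 2 * C₁)) * H :=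
    mul_le_mul_of_nonneg_right (by linarith only [hC₁0, hC₂0]) hH0.le
  refine ⟨hminus.trans hKle, hplus.trans hKle, ?_⟩
  have hlipD := hDl x (x - h) (hx0.trans hτρ) (hxm.trans hτρ)
  have hlipD' := hDl (x + h) (x - h + h) (hxp.trans hτρ) (hxmp.trans hτρ)
  rw [sub_sub_cancel, abs_of_pos hh] at hlipD
  rw [show x + h - (x - h + h) = h by ring, abs_of_pos hh] at hlipD'
  have hlipu := hulip _ _ (hxph.trans_lt hτR) (hxmh.trans_lt hτR)
  rw [show x + h / 2 - (x - h + h / 2) = h by ring, abs_of_pos hh] at hlipu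
  -- Between neighbouring interfaces `D`, `D'` and `deriv f ∘ u` each change by `O(h)`; this pays
  -- for the division by `h`.
  have hG := WENO.fluxCoeff_sub_le (α := α) hL.le
    ((hlin _ (hws _ hxmh) _ (hws _ hxph)).2.1.trans (mul_le_mul_of_nonneg_left hlipu hL.le))
    (hlin _ (hws _ hxmh) _ (hws _ hxmh)).1
    (hDb x (hx0.trans hτρ)).1 (hDb _ (hxp.trans hτρ)).2 hlipD.1 hlipD'.2
  rw [← hC₂] at hG
  rw [WENO.spatialOp, WENO.exactOp, show x - h / 2 = x - h + h / 2 by ring]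
  refine (WENO.abs_divided_difference_sub_le hh hH0.le (hflux x hx0 hxp hxph)
    (hflux (x - h) hxm hxmp hxmh) hG).trans ?_
  exact mul_le_mul_of_nonneg_right (by linarith only [hK]) hH0.le
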